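/- **The problem.** There are $N$ robots. Robot $i$ has a bounded state set $X^{(i)}\subset\mathbb R^{d_{x^{(i)}}}$, an action set $U^{(i)}\subset\mathbb R^{d_{u^{(i)}}}$, a (pseudo)metric $d$ on $X^{(i)}$ with $d(x,y)\le L\|x-y\|$ for some constant $L$, a collision shape $B^{(i)}(x)\subseteq\mathbb R^{d_w}$ for each state $x$, a start $x_s^{(i)}$ and a goal $x_f^{(i)}$, and dynamics $x_{k+1}=\mathrm{step}(x_k,u_k)=x_k+f^{(i)}(x_k,u_k)\Delta t$ with $\Delta t>0$, where $f^{(i)}$ is differentiable on $X^{(i)}\times U^{(i)}$ and does not depend on a (possibly empty) set of coordinates of $x$, the position coordinates. Let $W_{\rm free}\subseteq\mathbb R^{d_w}$. A *solution* consists of trajectories $(x^{(i)}_0,\dots,x^{(i)}_{K^{(i)}};u^{(i)}_0,\dots,u^{(i)}_{K^{(i)}-1})$, one for each robot, that obey the dynamics, have states in $X^{(i)}$ and actions in $U^{(i)}$, satisfy $B^{(i)}(x^{(i)}_k)\subseteq W_{\rm free}$, start at $x_s^{(i)}$, end at $x_f^{(i)}$, and satisfy $B^{(i)}(x^{(i)}_k)\cap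 B^{(j)}(x^{(j)}_k)=\emptyset$ for $i\ne j$ and all $k\le\min(K^{(i)},K^{(j)})$. It has *clearance* $\varepsilon>0$ if for all $i\ne j$ and $k$, whenever $y\in X^{(i)}$ and $d(x^{(i)}_k,y)\le\varepsilon$: $B^{(i)}(y)\subseteq W_{\rm free}$; $B^{(i)}(y)\cap B^{(j)}(z)=\emptyset$ for all $z\in X^{(j)}$ with $d(x^{(j)}_k,z)\le\varepsilon$ (for $k\le\min(K^{(i)},K^{(j)})$); and $y+v\in X^{(i)}$ for every position displacement $v$ with $\|v\|\le\varepsilon$. (The first and third conditions are required also if $N=1$.) **The planner.** db-CBS (discontinuity-bounded conflict-based search) works in iterations $n=0,1,2,\dots$. In iteration $n$ it has, for each robot $i$, a finite list $M_n^{(i)}$ of motion primitives (motions of length $K\ge1$ that obey the dynamics, with states in $X^{(i)}$ and actions in $U^{(i)}$) and a discontinuity bound $\delta_n>0$; $\alpha\in(0,1)$ is fixed. For a state $x$ and a primitive $m$, $x\oplus m$ is $m$ translated along the position coordinates so that it starts at the position of $x$. *Low level (db-A\*).* Given constraints $\langle x_c,k\rangle$ for robot $i$, explore nodes $x$, each with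 an arrival time $g$ and a path arriving then, beginning with $x_s^{(i)}$, $g=0$, in order of least $g+h$, where $h$ is an arbitrary heuristic. If a popped node $x$ has $d(x,x_f^{(i)})\le\delta_n$ (and its path obeys the constraints), return its path. Otherwise, for every $m\in M^{(i)}_n$ such that $x\oplus m$ starts within $\alpha\delta_n$ of $x$, is in $X^{(i)}$ and free of collisions with obstacles, and at time $k$ has distance $>\delta_n$ from $x_c$ for each constraint whose time $k$ falls into the motion: if no node explored so far is within $(1-\alpha)\delta_n$ of the end of $x\oplus m$, make that end a new open node; otherwise, each such node that had a larger arrival time gets the new arrival time and path, and is open again. If no open node is left, answer "infeasible". *High level.* The root of the constraint tree holds the unconstrained low-level paths of all robots. While there are open nodes, pop one of least total path length. If its paths have no conflict, pass them to a trajectory optimizer and report the result if it succeeds; otherwise take a conflict of robots $i,j$ with states $x^{(i)}_k,x^{(j)}_k$ at the earliest possible time $k$, and for each $c\in\{i,j\}$ add the child with the additional constraint $\langle x^{(c)}_k,k\rangle$ for robot $c$ and with a path of $c$ replanned under its constraints, if there is one. The iteration ends when no open node is left. Then the next iteration begins. **Assumptions.** 1. There is $\delta_0>0$ such that the optimizer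 returns a solution for all conflict-free paths that are $\delta_0$-discontinuity-bounded, i.e. satisfy $d(x_{k+1},\mathrm{step}(x_k,u_k))\le\delta_0$, $u_k\in U^{(i)}$, $x_k\in X^{(i)}$, $B^{(i)}(x_k)\subseteq W_{\rm free}$, $d(x_0,x_s^{(i)})\le\delta_0$ and $d(x_K,x_f^{(i)})\le\delta_0$. 2. For each robot $i$, $M_n^{(i)}$ consists of the first $s^{(i)}_n$ members of a sequence of independent random primitives with a common law $\mu^{(i)}$, where $s^{(i)}_n$ is nondecreasing in $n$. 3. $\delta_n\to0$, slowly enough in comparison to the number of primitives: for every robot $i$, every motion $m$ of length $K\ge 1$ that obeys the dynamics with states in $X^{(i)}$ and actions in $U^{(i)}$, and every $c>0$, $s_n^{(i)}\,\mu^{(i)}(\{m'\})\to\infty$ as $n\to\infty$, where $\{m'\}$ stands for the set of primitives $m'$ of the length of $m$ whose first state and actions differ from those of $m$ by at most $c\,\delta_n$ in Euclidean norm. **Theorem.** db-CBS is probabilistically complete: if there is a solution with clearance $\varepsilon$ for some $\varepsilon>0$, then the probability that db-CBS has reported a solution by the end of iteration $n$ tends to $1$ (and the probability that it has not tends to $0$)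 as $n\to\infty$; here reporting a solution in an iteration $m\le n$ includes that all iterations before $m$ terminate. -/

import Mathlib

open MeasureTheory ProbabilityTheory Filter Topology
open scoped ENNReal

noncomputable section

/-! ### The multi-robot kinodynamic motion planning problem -/

/-- A robot moving in a `dw`-dimensional workspace. `f` is the right-hand side of the dynamics,
`shape x` the collision shape occupied in state `x`, `dist` the distance between states, and
`pos` the set of position coordinates, along which motions may be translated (possibly empty). -/
structure Robot (dw : ℕ) where
  dx : ℕ
  du : ℕ
  X : Set (EuclideanSpace ℝ (Fin dx))
  U : Set (EuclideanSpace ℝ (Fin du))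
  f : EuclideanSpace ℝ (Fin dx) → EuclideanSpace ℝ (Fin du) → EuclideanSpace ℝ (Fin dx)
  shape : EuclideanSpace ℝ (Fin dx) → Set (EuclideanSpace ℝ (Fin dw))
  dist : EuclideanSpace ℝ (Fin dx) → EuclideanSpace ℝ (Fin dx) → ℝ
  pos : Finset (Fin dx)
  start : EuclideanSpace ℝ (Fin dx)
  goal : EuclideanSpace ℝ (Fin dx)

variable {dw : ℕ}

abbrev Robot.State (R : Robot dw) : Type := EuclideanSpace ℝ (Fin R.dx)

abbrev Robot.Action (R : Robot dw) : Type := EuclideanSpace ℝ (Fin R.du)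

/-- Standing assumptions on a robot: bounded state set, differentiable dynamics that do not depend
on the position coordinates, and a (pseudo)metric on the state set that is dominated by a multiple
of the Euclidean one (so that, for instance, angles may be identified modulo `2 * π`). -/
structure Robot.Regular (R : Robot dw) : Prop where
  bounded : Bornology.IsBounded R.X
  differentiable :
    DifferentiableOn ℝ (fun z : R.State × R.Action => R.f z.1 z.2) (R.X ×ˢ R.U)
  translation_invariant : ∀ x ∈ R.X, ∀ y ∈ R.X, ∀ u ∈ R.U,
    (∀ j, j ∉ R.pos → x j = y j) → R.f x u = R.f y u
  dist_self : ∀ x ∈ R.X, R.dist x x = 0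
  dist_comm : ∀ x ∈ R.X, ∀ y ∈ R.X, R.dist x y = R.dist y x
  dist_triangle : ∀ x ∈ R.X, ∀ y ∈ R.X, ∀ z ∈ R.X, R.dist x z ≤ R.dist x y + R.dist y z
  dist_le : ∃ L : ℝ, ∀ x ∈ R.X, ∀ y ∈ R.X, R.dist x y ≤ L * ‖x - y‖

/-- The explicit Euler step of length `dt`. -/
def Robot.step (R : Robot dw) (dt : ℝ) (x : R.State) (u : R.Action) : R.State :=
  x + dt • R.f x u

/-- A state sequence `x 0, …, x K` with an action sequence `u 0, …, u (K - 1)`; the values of `x`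
beyond `K` and of `u` from `K` on are irrelevant. -/
structure Traj (R : Robot dw) where
  K : ℕ
  x : ℕ → R.State
  u : ℕ → R.Action

/-- A problem instance: `N` robots, the collision-free part of the workspace, the time step. -/
structure Problem (dw : ℕ) where
  N : ℕ
  robot : Fin N → Robot dw
  free : Set (EuclideanSpace ℝ (Fin dw))
  dt : ℝ

/-- One trajectory for each robot. -/
abbrev Problem.Joint (Q : Problem dw) : Type := ∀ i, Traj (Q.robot i)

/-- An admissible state that does not collide with obstacles. -/
def Problem.StateFree (Q : Problem dw) (i : Fin Q.N) (x : (Q.robot i).State) : Prop :=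
  x ∈ (Q.robot i).X ∧ (Q.robot i).shape x ⊆ Q.free

/-- Robots `i ≠ j` collide at time `k`; both trajectories must still be running at time `k`. -/
def Problem.Conflict (Q : Problem dw) (Y : Q.Joint) (i j : Fin Q.N) (k : ℕ) : Prop :=
  i ≠ j ∧ k ≤ (Y i).K ∧ k ≤ (Y j).K ∧
    ¬ Disjoint ((Q.robot i).shape ((Y i).x k)) ((Q.robot j).shape ((Y j).x k))

/-- Feasible points of the multi-robot motion planning problem. -/
structure Problem.IsSolution (Q : Problem dw) (S : Q.Joint) : Prop where
  dynamics : ∀ i, ∀ k < (S i).K, (S i).x (k + 1) = (Q.robot i).step Q.dt ((S i).x k) ((S i).u k)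
  action_mem : ∀ i, ∀ k < (S i).K, (S i).u k ∈ (Q.robot i).U
  free : ∀ i, ∀ k ≤ (S i).K, Q.StateFree i ((S i).x k)
  no_conflict : ∀ i j k, ¬ Q.Conflict S i j k
  start : ∀ i, (S i).x 0 = (Q.robot i).start
  goal : ∀ i, (S i).x (S i).K = (Q.robot i).goal

/-- A joint trajectory has clearance `ε` if states that are `ε`-close to its states cause neither
collisions with obstacles nor collisions between robots, and remain admissible when their position
is displaced by at most `ε`. -/
structure Problem.HasClearance (Q : Problem dw) (S : Q.Joint) (ε : ℝ) : Prop where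
  obstacle : ∀ i, ∀ k ≤ (S i).K, ∀ y ∈ (Q.robot i).X, (Q.robot i).dist ((S i).x k) y ≤ ε →
    (Q.robot i).shape y ⊆ Q.free
  robots : ∀ i j, i ≠ j → ∀ k, k ≤ (S i).K → k ≤ (S j).K →
    ∀ y ∈ (Q.robot i).X, (Q.robot i).dist ((S i).x k) y ≤ ε →
    ∀ z ∈ (Q.robot j).X, (Q.robot j).dist ((S j).x k) z ≤ ε →
      Disjoint ((Q.robot i).shape y) ((Q.robot j).shape z)
  displacement : ∀ i, ∀ k ≤ (S i).K, ∀ y ∈ (Q.robot i).X, (Q.robot i).dist ((S i).x k) y ≤ ε →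
    ∀ v : (Q.robot i).State, (∀ j, j ∉ (Q.robot i).pos → v j = 0) → ‖v‖ ≤ ε →
      y + v ∈ (Q.robot i).X

/-- `δ`-discontinuity-bounded solutions of the single-robot problem of robot `i`. -/
structure Problem.DiscBounded (Q : Problem dw) (i : Fin Q.N) (δ : ℝ) (T : Traj (Q.robot i)) :
    Prop where
  jump : ∀ k < T.K,
    (Q.robot i).dist (T.x (k + 1)) ((Q.robot i).step Q.dt (T.x k) (T.u k)) ≤ δ
  action_mem : ∀ k < T.K, T.u k ∈ (Q.robot i).U
  free : ∀ k ≤ T.K, Q.StateFree i (T.x k)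
  start : (Q.robot i).dist (T.x 0) (Q.robot i).start ≤ δ
  goal : (Q.robot i).dist (T.x T.K) (Q.robot i).goal ≤ δ

/-! ### Motion primitives -/

/-- A motion primitive, given by its length, its first state and its actions; the other states
follow from the dynamics. -/
abbrev Robot.Prim (R : Robot dw) : Type := Σ K : ℕ, R.State × (Fin K → R.Action)

def Robot.Prim.action {R : Robot dw} (p : R.Prim) (k : ℕ) : R.Action :=
  if h : k < p.1 then p.2.2 ⟨k, h⟩ else 0

def Robot.Prim.state {R : Robot dw} (dt : ℝ) (p : R.Prim) : ℕ → R.State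
  | 0 => p.2.1
  | k + 1 => R.step dt (Robot.Prim.state dt p k) (Robot.Prim.action p k)

/-- A primitive takes at least one time step and respects the state and action bounds. -/
def Robot.Prim.Valid {R : Robot dw} (dt : ℝ) (p : R.Prim) : Prop :=
  0 < p.1 ∧ (∀ k < p.1, Robot.Prim.action p k ∈ R.U) ∧ ∀ k ≤ p.1, Robot.Prim.state dt p k ∈ R.X

/-- `q` has the length of `p`, and its first state and all its actions are `r`-close to those
of `p`. -/
def Robot.Prim.Near {R : Robot dw} (r : ℝ) (p q : R.Prim) : Prop :=
  q.1 = p.1 ∧ ‖q.2.1 - p.2.1‖ ≤ r ∧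
    ∀ k < p.1, ‖Robot.Prim.action q k - Robot.Prim.action p k‖ ≤ r

/-- The position part of a vector. -/
def Robot.posPart (R : Robot dw) (v : R.State) : R.State :=
  WithLp.toLp 2 fun j => if j ∈ R.pos then v j else 0

/-- The motion `x ⊕ p`: the primitive `p` translated so that it starts at the position of `x`. -/
def Robot.applyPrim (R : Robot dw) (dt : ℝ) (x : R.State) (p : R.Prim) : Traj R where
  K := p.1
  x k := Robot.Prim.state dt p k + R.posPart (x - p.2.1)
  u k := Robot.Prim.action p k

/-- Concatenation; at the junction the state is the first state of the second motion. -/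
def Traj.append {R : Robot dw} (S T : Traj R) : Traj R where
  K := S.K + T.K
  x k := if k < S.K then S.x k else T.x (k - S.K)
  u k := if k < S.K then S.u k else T.u (k - S.K)

/-! ### The low-level planner: db-A* with dynamic obstacles -/

/-- A constraint: stay away from `state` at time `time`. -/
structure Constr (R : Robot dw) where
  state : R.State
  time : ℕ

/-- The constraints `C` forbid the motion `T` started at time `g`. -/
def Traj.Violates {R : Robot dw} (T : Traj R) (g : ℕ) (δ : ℝ) (C : List (Constr R)) : Prop :=
  ∃ c ∈ C, g ≤ c.time ∧ c.time ≤ g + T.K ∧ R.dist (T.x (c.time - g)) c.state ≤ δ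

/-- A search node. The arrival time (cost-to-come) `g` is the length of `path`. Storing with each
arrival the path it belongs to replaces the list of arrival times, parents and motions from which
that path would be traced back. -/
structure LowNode (R : Robot dw) where
  x : R.State
  path : Traj R

def LowNode.g {R : Robot dw} (n : LowNode R) : ℕ := n.path.K

/-- State of the search: the nodes `0, …, size - 1` explored so far, the open queue, and the
result: `none` while running, `some none` for "infeasible", `some (some T)` for a path `T`. -/
structure LowState (R : Robot dw) where
  node : ℕ → LowNode R
  size : ℕ
  openSet : Finset ℕ
  result : Option (Option (Traj R))

/-- The parameters of the planner: the discontinuity split `α`, the heuristics `h`, and the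
trajectory optimizer `opt`, which returns `none` if it fails. -/
structure Planner (Q : Problem dw) where
  α : ℝ
  h : ∀ i, (Q.robot i).State → ℝ
  opt : Q.Joint → Option Q.Joint

namespace Planner

variable {Q : Problem dw} (A : Planner Q) (i : Fin Q.N)

def lowInit : LowState (Q.robot i) where
  node := fun _ => ⟨(Q.robot i).start, ⟨0, fun _ => (Q.robot i).start, fun _ => 0⟩⟩
  size := 1
  openSet := {0}
  result := none

open Classical in
/-- Extend the popped node `n` by the primitive `p`. -/
def lowExtend (δ : ℝ) (C : List (Constr (Q.robot i))) (n : LowNode (Q.robot i))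
    (s : LowState (Q.robot i)) (p : (Q.robot i).Prim) : LowState (Q.robot i) :=
  let m := (Q.robot i).applyPrim Q.dt n.x p
  if (Q.robot i).dist n.x (m.x 0) ≤ A.α * δ ∧ (∀ k ≤ m.K, Q.StateFree i (m.x k)) ∧
      ¬ m.Violates n.g δ C then
    let path := n.path.append m
    let near := (Finset.range s.size).filter fun b =>
      (Q.robot i).dist (s.node b).x (m.x m.K) ≤ (1 - A.α) * δ
    if near = ∅ then
      { s with
        node := Function.update s.node s.size ⟨m.x m.K, path⟩
        size := s.size + 1
        openSet := insert s.size s.openSet }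
    else
      let better := near.filter fun b => path.K < (s.node b).g
      { s with
        node := fun b => if b ∈ better then ⟨(s.node b).x, path⟩ else s.node b
        openSet := s.openSet ∪ better }
  else s

open Classical in
/-- One pass of the main loop: pop a node with least `g + h`; stop if it is `δ`-close to the goal
(and its path obeys the constraints, which has to be tested for the path that never leaves the
start only); otherwise extend it by all primitives. -/
def lowStep (M : List (Q.robot i).Prim) (δ : ℝ) (C : List (Constr (Q.robot i)))
    (s : LowState (Q.robot i)) : LowState (Q.robot i) :=
  if s.result ≠ none then s
  else if hne : s.openSet.Nonempty then
    let a := (s.openSet.exists_min_image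
      (fun b => ((s.node b).g : ℝ) + A.h i (s.node b).x) hne).choose
    let n := s.node a
    if (Q.robot i).dist n.x (Q.robot i).goal ≤ δ ∧ ¬ n.path.Violates 0 δ C then
      { s with result := some (some n.path) }
    else
      M.foldl (A.lowExtend i δ C n) { s with openSet := s.openSet.erase a }
  else { s with result := some none }

def lowRun (M : List (Q.robot i).Prim) (δ : ℝ) (C : List (Constr (Q.robot i))) (t : ℕ) :
    LowState (Q.robot i) :=
  (A.lowStep i M δ C)^[t] (lowInit i)

open Classical in
/-- The value of the low-level planner, `none` if it does not terminate. -/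
def dbAstar (M : List (Q.robot i).Prim) (δ : ℝ) (C : List (Constr (Q.robot i))) :
    Option (Option (Traj (Q.robot i))) :=
  if ht : ∃ t, (A.lowRun i M δ C t).result ≠ none then (A.lowRun i M δ C (Nat.find ht)).result
  else none

end Planner

/-! ### The high-level search: db-CBS -/

/-- A node of the constraint tree. -/
structure HighNode (Q : Problem dw) where
  solution : Q.Joint
  constraints : ∀ i, List (Constr (Q.robot i))

def HighNode.cost {Q : Problem dw} (P : HighNode Q) : ℕ := ∑ i, (P.solution i).K

/-- The open queue of an iteration, and the trajectories reported in it so far. -/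
structure HighState (Q : Problem dw) where
  openList : List (HighNode Q)
  reports : List Q.Joint

open Classical in
/-- A conflict at the earliest time at which there is one. -/
def Problem.earliestConflict (Q : Problem dw) (Y : Q.Joint) : Option (Fin Q.N × Fin Q.N × ℕ) :=
  if hc : ∃ k, ∃ ij : Fin Q.N × Fin Q.N, Q.Conflict Y ij.1 ij.2 k then
    let ij := (Nat.find_spec hc).choose
    some (ij.1, ij.2, Nat.find hc)
  else none

namespace Planner

variable {Q : Problem dw} (A : Planner Q) (M : ∀ i, List (Q.robot i).Prim) (δ : ℝ)

open Classical in
/-- The root of the constraint tree, if all robots have paths; `none` if a low-level search does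
not terminate. -/
def highInit : Option (HighState Q) :=
  if ∃ i, A.dbAstar i (M i) δ [] = none then none
  else if hY : ∃ Y : Q.Joint, ∀ i, A.dbAstar i (M i) δ [] = some (some (Y i)) then
    some ⟨[⟨hY.choose, fun _ => []⟩], []⟩
  else some ⟨[], []⟩

/-- The child of `P` with a new constraint on robot `c` at time `k`: `some []` if there is no path
obeying the constraints, `none` if the low-level search does not terminate. -/
def child (P : HighNode Q) (c : Fin Q.N) (k : ℕ) : Option (List (HighNode Q)) :=
  let C := Function.update P.constraints c (⟨(P.solution c).x k, k⟩ :: P.constraints c)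
  match A.dbAstar c (M c) δ (C c) with
  | none => none
  | some none => some []
  | some (some T) => some [⟨Function.update P.solution c T, C⟩]

open Classical in
/-- One pass of the main loop. A pass in which a low-level search does not terminate leaves the
state unchanged, so that the loop runs forever without any effect. -/
def highStep (s : HighState Q) : HighState Q :=
  match s.openList.argmin HighNode.cost with
  | none => s
  | some P =>
    match Q.earliestConflict P.solution with
    | none => ⟨s.openList.erase P, (A.opt P.solution).toList ++ s.reports⟩
    | some (i, j, k) =>
      match A.child M δ P i k, A.child M δ P j k with
      | some l, some l' => ⟨s.openList.erase P ++ l ++ l', s.reports⟩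
      | _, _ => s

/-- The iteration with primitives `M` and discontinuity bound `δ` comes to an end. -/
def Terminates : Prop :=
  ∃ s, A.highInit M δ = some s ∧ ∃ t, ((A.highStep M δ)^[t] s).openList = []

/-- The iteration with primitives `M` and discontinuity bound `δ` reports a solution. -/
def ReportsSolution : Prop :=
  ∃ s, A.highInit M δ = some s ∧ ∃ t, ∃ S ∈ ((A.highStep M δ)^[t] s).reports, Q.IsSolution S

/-- The planner, whose `n`-th iteration uses the primitives `M n` and the bound `δ n`, reports a
solution in an iteration `m ≤ n`, which it reaches because all earlier ones terminate. -/
def FoundBy (M : ℕ → ∀ i, List (Q.robot i).Prim) (δ : ℕ → ℝ) (n : ℕ) : Prop :=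
  ∃ m ≤ n, (∀ l < m, A.Terminates (M l) (δ l)) ∧ A.ReportsSolution (M m) (δ m)

end Planner

end

/-!
# Probabilistic completeness of db-CBS

Every iteration terminates, and a late iteration reports a solution with probability close to one.

**Termination.** Bounded state sets split into finitely many classes of small diameter
(`Robot.Regular.exists_finite_classes`). In the low-level search distinct nodes are separated, hence
their number is bounded; arrival times are natural numbers that only decrease, so that a potential
drops in each pass (`Planner.LowInv.lowStep`). Neither the number of nodes nor the bound on path
lengths depends on the constraints (`Planner.exists_dbAstar_eq_some`). In the constraint tree the
constraints of one robot at one time are separated, because each of them is a state of a path that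
obeyed the earlier ones, and their times are bounded by the path lengths. So the tree has bounded
depth, and the high-level search ends (`Planner.terminates`).

**Success.** Let `S` be a solution with clearance. The low-level search keeps just the earliest
arrival at each node, which makes it incomplete in general once there are time-dependent
constraints. This does no harm, since a *single* primitive close to the whole of `S i` is available:
applied at the start at time `0`, it follows `S i` with an error proportional to the distance of the
two (`Robot.exists_norm_state_sub_le`, by differentiability of the dynamics), so that it is admitted
by all constraints that stay away from `S i`, and it ends so close to the goal that a node that
absorbs its end is still a goal node (`Problem.IsSolution.exists_leadsToGoal`,
`Planner.exists_dbAstar_eq_some_some`). In the high-level search, when two paths collide, clearance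
of `S` prevents both from being close to `S`, so one of the two new constraints stays away from `S`
(`Planner.constrAvoid_cons_or`). Therefore a node whose constraints all stay away from `S` is
waiting until a solution has been reported, and since the search ends, one is reported
(`Planner.reportsSolution`).

**Probability.** The probability that `s` independent samples miss a set is at most the reciprocal
of the expected number of hits (`measure_forall_notMem_le`), which tends to zero for the primitives
close to `S i` by the assumption on the discontinuity bounds.
-/

noncomputable section

variable {dw : ℕ}

/-! ### Geometry of the state sets and of translated motions -/

namespace Robot.Regular

variable {R : Robot dw}

theorem exists_pos_dist_le (hR : R.Regular) :
    ∃ L > 0, ∀ x ∈ R.X, ∀ y ∈ R.X, R.dist x y ≤ L * ‖x - y‖ := by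
  obtain ⟨L, hL⟩ := hR.dist_le
  refine ⟨max L 1, lt_max_of_lt_right one_pos, fun x hx y hy => (hL x hx y hy).trans ?_⟩
  gcongr
  exact le_max_left _ _

/-- A bounded state set splits into finitely many classes of small diameter. This compactness
statement is what bounds both the number of search nodes and the number of constraints. -/
theorem exists_finite_classes (hR : R.Regular) {η : ℝ} (hη : 0 < η) :
    ∃ (t : Finset R.State) (cls : R.State → R.State), (∀ x ∈ R.X, cls x ∈ t) ∧
      ∀ x ∈ R.X, ∀ y ∈ R.X, cls x = cls y → R.dist x y ≤ η := by
  obtain ⟨L, hL, hd⟩ := hR.exists_pos_dist_le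
  have htb : TotallyBounded R.X :=
    hR.bounded.isCompact_closure.totallyBounded.subset subset_closure
  obtain ⟨t, ht, hcov⟩ := Metric.totallyBounded_iff.1 htb (η / (2 * L)) (by positivity)
  have hex : ∀ x : R.State, ∃ y, x ∈ R.X → y ∈ t ∧ x ∈ Metric.ball y (η / (2 * L)) := by
    intro x
    by_cases hx : x ∈ R.X
    · obtain ⟨y, hy, hxy⟩ := Set.mem_iUnion₂.1 (hcov hx)
      exact ⟨y, fun _ => ⟨hy, hxy⟩⟩
    · exact ⟨x, fun h => absurd h hx⟩
  choose cls hcls using hex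
  refine ⟨ht.toFinset, cls, fun x hx => ht.mem_toFinset.2 (hcls x hx).1, fun x hx y hy hxy => ?_⟩
  have h1 := (hcls x hx).2
  have h2 := (hcls y hy).2
  rw [← hxy] at h2
  have h3 : Dist.dist x y ≤ η / (2 * L) + η / (2 * L) :=
    (dist_triangle_right x y (cls x)).trans
      (add_le_add (Metric.mem_ball.1 h1).le (Metric.mem_ball.1 h2).le)
  calc R.dist x y ≤ L * ‖x - y‖ := hd x hx y hy
    _ ≤ L * (η / (2 * L) + η / (2 * L)) := by
        rw [← dist_eq_norm]
        gcongr
    _ = η := by field_simp; ring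

end Robot.Regular

namespace Robot

variable {R : Robot dw}

theorem posPart_apply_of_notMem {v : R.State} {j : Fin R.dx} (hj : j ∉ R.pos) :
    R.posPart v j = 0 := by
  simp [posPart, hj]

theorem norm_posPart_le (v : R.State) : ‖R.posPart v‖ ≤ ‖v‖ := by
  rw [EuclideanSpace.norm_eq, EuclideanSpace.norm_eq]
  refine Real.sqrt_le_sqrt (Finset.sum_le_sum fun j _ => ?_)
  by_cases hj : j ∈ R.pos <;> simp [posPart, hj, sq_nonneg]

/-- Translated primitives obey the dynamics exactly. -/
theorem applyPrim_x_succ (hR : R.Regular) {dt : ℝ} {p : R.Prim} (hp : p.Valid dt) (x : R.State)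
    {k : ℕ} (hk : k < p.1) (hX : (R.applyPrim dt x p).x k ∈ R.X) :
    (R.applyPrim dt x p).x (k + 1) =
      R.step dt ((R.applyPrim dt x p).x k) ((R.applyPrim dt x p).u k) := by
  have hf := hR.translation_invariant _ (hp.2.2 k hk.le) _ hX _ (hp.2.1 k hk) fun j hj => by
    simp [applyPrim, posPart_apply_of_notMem hj]
  change R.step dt (p.state dt k) (p.action k) + _ = _
  simp only [step]
  rw [hf]
  simp only [applyPrim]
  abel

/-- Primitives whose first state and actions are close to those of `p` stay close to `p`: the
distance of the states is at most proportional to the perturbation, because the dynamics are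
differentiable along `p`. -/
theorem exists_norm_state_sub_le (hR : R.Regular) {dt : ℝ} {p : R.Prim} (hp : p.Valid dt) :
    ∃ c > 0, ∃ r₀ > 0, ∀ r, 0 ≤ r → r ≤ r₀ → ∀ q : R.Prim, q.Valid dt → Prim.Near r p q →
      ∀ k ≤ p.1, ‖q.state dt k - p.state dt k‖ ≤ c * r := by
  suffices H : ∀ n ≤ p.1, ∃ c > 0, ∃ r₀ > 0, ∀ r, 0 ≤ r → r ≤ r₀ → ∀ q : R.Prim, q.Valid dt →
      Prim.Near r p q → ∀ k ≤ n, ‖q.state dt k - p.state dt k‖ ≤ c * r from H p.1 le_rfl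
  intro n
  induction n with
  | zero =>
    refine fun _ => ⟨1, one_pos, 1, one_pos, fun r _ _ q _ hq k hk => ?_⟩
    obtain rfl : k = 0 := by omega
    simpa [Prim.state] using hq.2.1
  | succ n ih =>
    intro hn
    obtain ⟨c, hc, r₀, hr₀, H⟩ := ih (by omega)
    have hO := (hR.differentiable (p.state dt n, p.action n)
      ⟨hp.2.2 n (by omega), hp.2.1 n (by omega)⟩).hasFDerivWithinAt.isBigO_sub
    obtain ⟨l, hl, hO⟩ := hO.exists_pos
    rw [Asymptotics.IsBigOWith, eventually_nhdsWithin_iff, Metric.eventually_nhds_iff] at hO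
    obtain ⟨ρ, hρ, hO⟩ := hO
    -- The perturbation of the pair of state and action is at most `(c + 1) * r`.
    refine ⟨c + |dt| * (l * (c + 1)), by positivity, min r₀ (ρ / (2 * (c + 1))),
      by positivity, fun r hr hrr q hqv hq k hk => ?_⟩
    have hstate := H r hr (hrr.trans (min_le_left _ _)) q hqv hq
    have hpos : 0 ≤ |dt| * (l * (c + 1)) * r := by positivity
    rcases Nat.lt_or_ge n k with hnk | hnk
    · obtain rfl : k = n + 1 := by omega
      have h1 := hstate n le_rfl
      have h2 := hq.2.2 n (by omega)
      have hpair : ‖(q.state dt n, q.action n) - (p.state dt n, p.action n)‖ ≤ (c + 1) * r := by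
        rw [Prod.mk_sub_mk, Prod.norm_def]
        exact max_le (by nlinarith) (by nlinarith)
      have hclose : Dist.dist (q.state dt n, q.action n) (p.state dt n, p.action n) < ρ := by
        rw [dist_eq_norm]
        have : (c + 1) * r ≤ (c + 1) * (ρ / (2 * (c + 1))) := by
          gcongr
          exact hrr.trans (min_le_right _ _)
        have h3 : (c + 1) * (ρ / (2 * (c + 1))) = ρ / 2 := by field_simp
        linarith
      have hf := hO hclose ⟨hqv.2.2 n (by rw [hq.1]; omega), hqv.2.1 n (by rw [hq.1]; omega)⟩
      have hf' : ‖R.f (q.state dt n) (q.action n) - R.f (p.state dt n) (p.action n)‖ ≤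
          l * ((c + 1) * r) := hf.trans (by gcongr)
      calc ‖q.state dt (n + 1) - p.state dt (n + 1)‖
          = ‖(q.state dt n - p.state dt n) +
              dt • (R.f (q.state dt n) (q.action n) - R.f (p.state dt n) (p.action n))‖ := by
            simp only [Prim.state, step, smul_sub]
            congr 1
            abel
        _ ≤ c * r + |dt| * (l * ((c + 1) * r)) := by
            refine (norm_add_le _ _).trans (add_le_add h1 ?_)
            rw [norm_smul, Real.norm_eq_abs]
            gcongr
        _ = (c + |dt| * (l * (c + 1))) * r := by ring
    · have := hstate k hnk
      nlinarith

end Robot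

/-! ### Paths stored by the low-level search -/

namespace Problem

variable {Q : Problem dw} {i : Fin Q.N} {δ : ℝ}

/-- A path from the start with free states, whose discontinuities are at most `δ`. The last action
leads exactly to the last state; this is what keeps the discontinuity small when the path is
continued from a search node that merely lies close to its end. -/
structure DiscPath (Q : Problem dw) (i : Fin Q.N) (δ : ℝ) (T : Traj (Q.robot i)) : Prop where
  jump : ∀ k < T.K,
    (Q.robot i).dist (T.x (k + 1)) ((Q.robot i).step Q.dt (T.x k) (T.u k)) ≤ δ
  last : ∀ k, k + 1 = T.K → T.x (k + 1) = (Q.robot i).step Q.dt (T.x k) (T.u k)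
  action_mem : ∀ k < T.K, T.u k ∈ (Q.robot i).U
  free : ∀ k ≤ T.K, Q.StateFree i (T.x k)
  start : (Q.robot i).dist (T.x 0) (Q.robot i).start ≤ δ

theorem DiscPath.append {T : Traj (Q.robot i)} {β : ℝ} (hR : (Q.robot i).Regular) (hδ : 0 ≤ δ)
    (hβδ : β ≤ δ) (hT : Q.DiscPath i δ T) {x : (Q.robot i).State}
    (hx : x ∈ (Q.robot i).X)
    (hend : (Q.robot i).dist (T.x T.K) x ≤ δ - β)
    (hstart : T.K = 0 → x = (Q.robot i).start)
    {p : (Q.robot i).Prim} (hp : p.Valid Q.dt)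
    (h0 : (Q.robot i).dist x (((Q.robot i).applyPrim Q.dt x p).x 0) ≤ β)
    (hfree : ∀ k ≤ p.1, Q.StateFree i (((Q.robot i).applyPrim Q.dt x p).x k)) :
    Q.DiscPath i δ (T.append ((Q.robot i).applyPrim Q.dt x p)) := by
  have hstep : ∀ k < p.1, ((Q.robot i).applyPrim Q.dt x p).x (k + 1) =
      (Q.robot i).step Q.dt (((Q.robot i).applyPrim Q.dt x p).x k)
        (((Q.robot i).applyPrim Q.dt x p).u k) := fun k hk =>
    Robot.applyPrim_x_succ hR hp x hk (hfree k hk.le).1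
  have hmU : ∀ k < p.1, ((Q.robot i).applyPrim Q.dt x p).u k ∈ (Q.robot i).U := hp.2.1
  have hmK : ((Q.robot i).applyPrim Q.dt x p).K = p.1 := rfl
  have hp0 := hp.1
  generalize (Q.robot i).applyPrim Q.dt x p = m at *
  have hm0 := (hfree 0 (Nat.zero_le _)).1
  constructor
  · intro k hk
    simp only [Traj.append] at hk ⊢
    rcases lt_trichotomy (k + 1) T.K with h | h | h
    · rw [if_pos h, if_pos (by omega), if_pos (by omega)]
      exact hT.jump k (by omega)
    · rw [if_neg (by omega), if_pos (by omega), if_pos (by omega), ← hT.last k h, h, Nat.sub_self]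
      have hTX := (hT.free T.K le_rfl).1
      rw [hR.dist_comm _ hm0 _ hTX]
      linarith [hR.dist_triangle _ hTX _ hx _ hm0]
    · rw [if_neg (by omega), if_neg (by omega), if_neg (by omega),
        show k + 1 - T.K = k - T.K + 1 by omega, ← hstep _ (by omega),
        hR.dist_self _ (hfree _ (by omega)).1]
      exact hδ
  · intro k hk
    simp only [Traj.append] at hk ⊢
    rw [if_neg (by omega), if_neg (by omega), if_neg (by omega),
      show k + 1 - T.K = k - T.K + 1 by omega]
    exact hstep _ (by omega)
  · intro k hk
    simp only [Traj.append] at hk ⊢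
    split_ifs with h
    · exact hT.action_mem k h
    · exact hmU _ (by omega)
  · intro k hk
    simp only [Traj.append] at hk ⊢
    split_ifs with h
    · exact hT.free k h.le
    · exact hfree _ (by omega)
  · simp only [Traj.append]
    split_ifs with h
    · exact hT.start
    · rw [Nat.zero_sub, ← hstart (by omega), hR.dist_comm _ hm0 _ hx]
      exact h0.trans hβδ

/-- The requirements on an answer of the low-level planner: a correct path that obeys the
constraints `C` and has at most `K` steps. -/
structure PathOK (Q : Problem dw) (i : Fin Q.N) (K : ℕ) (δ : ℝ) (C : List (Constr (Q.robot i)))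
    (T : Traj (Q.robot i)) : Prop where
  length_le : T.K ≤ K
  discBounded : Q.DiscBounded i (2 * δ) T
  not_violates : ¬ T.Violates 0 δ C

theorem DiscPath.discBounded {T : Traj (Q.robot i)} {η : ℝ} (hT : Q.DiscPath i δ T) (hδη : δ ≤ η)
    (hgoal : (Q.robot i).dist (T.x T.K) (Q.robot i).goal ≤ η) : Q.DiscBounded i η T where
  jump k hk := (hT.jump k hk).trans hδη
  action_mem := hT.action_mem
  free := hT.free
  start := hT.start.trans hδη
  goal := hgoal

end Problem

theorem Traj.append_x_K {R : Robot dw} (S T : Traj R) :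
    (S.append T).x (S.append T).K = T.x T.K := by
  simp [Traj.append]

theorem Traj.Violates.append {R : Robot dw} {S T : Traj R} {δ : ℝ} {C : List (Constr R)}
    (h : (S.append T).Violates 0 δ C) : S.Violates 0 δ C ∨ T.Violates S.K δ C := by
  obtain ⟨c, hc, -, h2, h3⟩ := h
  simp only [Traj.append, Nat.sub_zero] at h2 h3
  split_ifs at h3 with hk
  · exact Or.inl ⟨c, hc, Nat.zero_le _, by omega, h3⟩
  · exact Or.inr ⟨c, hc, by omega, by omega, h3⟩

/-! ### Invariants and termination of the low-level search -/

namespace Planner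

variable {Q : Problem dw} (A : Planner Q) (i : Fin Q.N)

open Classical in
/-- The three outcomes of an extension: it is rejected, it creates a node far from all others, or
it shortens the paths to the nodes close to its end. -/
theorem lowExtend_cases (δ : ℝ) (C : List (Constr (Q.robot i))) (n : LowNode (Q.robot i))
    (s : LowState (Q.robot i)) (p : (Q.robot i).Prim) :
    let m := (Q.robot i).applyPrim Q.dt n.x p
    let ok := (Q.robot i).dist n.x (m.x 0) ≤ A.α * δ ∧ (∀ k ≤ m.K, Q.StateFree i (m.x k)) ∧
      ¬ m.Violates n.g δ C
    (¬ ok ∧ A.lowExtend i δ C n s p = s) ∨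
    (ok ∧ (∀ b < s.size, (1 - A.α) * δ < (Q.robot i).dist (s.node b).x (m.x m.K)) ∧
      A.lowExtend i δ C n s p =
        { s with
          node := Function.update s.node s.size ⟨m.x m.K, n.path.append m⟩
          size := s.size + 1
          openSet := insert s.size s.openSet }) ∨
    (ok ∧ (∃ b < s.size, (Q.robot i).dist (s.node b).x (m.x m.K) ≤ (1 - A.α) * δ) ∧
      ∃ better : Finset ℕ, (∀ b, b ∈ better ↔ (b < s.size ∧
          (Q.robot i).dist (s.node b).x (m.x m.K) ≤ (1 - A.α) * δ) ∧
          (n.path.append m).K < (s.node b).g) ∧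
        A.lowExtend i δ C n s p =
          { s with
            node := fun b => if b ∈ better then ⟨(s.node b).x, n.path.append m⟩ else s.node b
            openSet := s.openSet ∪ better }) := by
  intro m ok
  by_cases hok : ok
  · right
    set near := (Finset.range s.size).filter fun b =>
      (Q.robot i).dist (s.node b).x (m.x m.K) ≤ (1 - A.α) * δ with hnear
    have hmem : ∀ b, b ∈ near ↔ b < s.size ∧
        (Q.robot i).dist (s.node b).x (m.x m.K) ≤ (1 - A.α) * δ := fun b => by
      rw [hnear, Finset.mem_filter, Finset.mem_range]
    by_cases hemp : near = ∅
    · refine Or.inl ⟨hok, fun b hb => ?_, ?_⟩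
      · by_contra hcon
        exact absurd ((hmem b).2 ⟨hb, not_lt.1 hcon⟩) (by simp [hemp])
      · unfold lowExtend
        exact (if_pos hok).trans (if_pos hemp)
    · refine Or.inr ⟨hok, ?_, near.filter fun b => (n.path.append m).K < (s.node b).g, ?_, ?_⟩
      · obtain ⟨b, hb⟩ := Finset.nonempty_iff_ne_empty.2 hemp
        exact ⟨b, (hmem b).1 hb⟩
      · intro b
        rw [Finset.mem_filter, hmem]
      · unfold lowExtend
        refine (if_pos hok).trans ((if_neg hemp).trans ?_)
        simp only
        congr!
  · exact Or.inl ⟨hok, by unfold lowExtend; exact if_neg hok⟩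

/-- A node of the search graph carries a path whose end is close to its state. -/
structure NodeOK (δ : ℝ) (n : LowNode (Q.robot i)) : Prop where
  mem : n.x ∈ (Q.robot i).X
  path : Q.DiscPath i δ n.path
  near_end : (Q.robot i).dist (n.path.x n.path.K) n.x ≤ δ - A.α * δ
  eq_start : n.path.K = 0 → n.x = (Q.robot i).start

/-- Invariant of the search. The nodes are well separated, and since every new node is reached from
an older one, the arrival time at the `b`-th node is at most `b` times the greatest length `B` of
a primitive. -/
structure LowInv (B : ℕ) (δ : ℝ) (s : LowState (Q.robot i)) : Prop where
  open_lt : ∀ b ∈ s.openSet, b < s.size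
  node_ok : ∀ b < s.size, A.NodeOK i δ (s.node b)
  separated : ∀ a b, a < b → b < s.size →
    (1 - A.α) * δ < (Q.robot i).dist (s.node a).x (s.node b).x
  time_le : ∀ b < s.size, (s.node b).g ≤ b * B

variable {A i} {B : ℕ} {δ : ℝ} {C : List (Constr (Q.robot i))} {s : LowState (Q.robot i)}
  {n : LowNode (Q.robot i)} {p : (Q.robot i).Prim}

theorem lowInv_init (hR : (Q.robot i).Regular) (hα : 0 < A.α ∧ A.α < 1) (hδ : 0 < δ)
    (hstart : Q.StateFree i (Q.robot i).start) : A.LowInv i B δ (lowInit i) := by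
  have h0 := hR.dist_self _ hstart.1
  constructor
  · intro b hb
    simpa [lowInit] using hb
  · intro b _
    refine ⟨hstart.1, ⟨?_, ?_, ?_, fun _ _ => hstart, h0.le.trans hδ.le⟩, ?_, fun _ => rfl⟩
    · intro k hk
      simp [lowInit] at hk
    · intro k hk
      simp [lowInit] at hk
    · intro k hk
      simp [lowInit] at hk
    · refine h0.le.trans ?_
      nlinarith
  · intro a b hab hb
    simp only [lowInit] at hb
    omega
  · intro b _
    simp [lowInit, LowNode.g]

theorem LowInv.lowExtend (hR : (Q.robot i).Regular) (hα : 0 < A.α ∧ A.α < 1) (hδ : 0 < δ)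
    (hs : A.LowInv i B δ s) (hn : A.NodeOK i δ n) {a : ℕ} (ha : a < s.size) (hna : n.g ≤ a * B)
    (hp : p.Valid Q.dt) (hpB : p.1 ≤ B) : A.LowInv i B δ (A.lowExtend i δ C n s p) := by
  have hnew : ∀ b, s.size ≤ b → n.path.K + p.1 ≤ b * B := fun b hb => by
    have : (a + 1) * B ≤ b * B := Nat.mul_le_mul_right _ (by omega)
    have : n.path.K ≤ a * B := hna
    nlinarith
  have hαδ : 0 < A.α * δ := mul_pos hα.1 hδ
  have hαδ' : A.α * δ < δ := by nlinarith
  rcases A.lowExtend_cases i δ C n s p with ⟨-, h⟩ | ⟨hok, hfar, h⟩ | ⟨hok, -, better, hb, h⟩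
  · rwa [h]
  · rw [h]
    have hpath := hn.path.append hR hδ.le hαδ'.le hn.mem hn.near_end hn.eq_start hp hok.1
      hok.2.1
    have hnodeOK : A.NodeOK i δ ⟨((Q.robot i).applyPrim Q.dt n.x p).x
        ((Q.robot i).applyPrim Q.dt n.x p).K,
        n.path.append ((Q.robot i).applyPrim Q.dt n.x p)⟩ := by
      refine ⟨(hok.2.1 p.1 le_rfl).1, hpath, ?_, ?_⟩
      · simp only
        rw [Traj.append_x_K]
        exact (hR.dist_self _ (hok.2.1 p.1 le_rfl).1).le.trans (by linarith)
      · intro h0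
        have := hp.1
        simp only [Traj.append, Robot.applyPrim] at h0
        omega
    constructor
    · intro b hb
      rcases Finset.mem_insert.1 hb with rfl | hb
      · exact Nat.lt_succ_self _
      · exact (hs.open_lt b hb).trans (Nat.lt_succ_self _)
    · intro b hb
      rcases eq_or_ne b s.size with rfl | hne
      · simpa only [Function.update_self] using hnodeOK
      · simpa only [Function.update_of_ne hne] using hs.node_ok b (by simp only at hb; omega)
    · intro a' b hab hb
      simp only at hb ⊢
      rw [Function.update_of_ne (show a' ≠ s.size by omega)]
      rcases eq_or_ne b s.size with rfl | hne
      · rw [Function.update_self]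
        exact hfar a' hab
      · rw [Function.update_of_ne hne]
        exact hs.separated a' b hab (by omega)
    · intro b hb
      simp only at hb ⊢
      rcases eq_or_ne b s.size with rfl | hne
      · rw [Function.update_self]
        exact hnew _ le_rfl
      · rw [Function.update_of_ne hne]
        exact hs.time_le b (by omega)
  · rw [h]
    have hpath := hn.path.append hR hδ.le hαδ'.le hn.mem hn.near_end hn.eq_start hp hok.1
      hok.2.1
    constructor
    · intro b hbo
      rcases Finset.mem_union.1 hbo with hbo | hbo
      · exact hs.open_lt b hbo
      · exact ((hb b).1 hbo).1.1
    · intro b hbs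
      simp only
      split_ifs with hbb
      · refine ⟨(hs.node_ok b hbs).mem, hpath, ?_, ?_⟩
        · simp only
          rw [Traj.append_x_K, hR.dist_comm _ (hok.2.1 _ le_rfl).1 _ (hs.node_ok b hbs).mem]
          exact ((hb b).1 hbb).1.2.trans (by linarith)
        · intro h0
          have := hp.1
          simp only [Traj.append, Robot.applyPrim] at h0
          omega
      · exact hs.node_ok b hbs
    · intro a' b hab hbs
      have hx : ∀ b, (if b ∈ better then (⟨(s.node b).x, n.path.append
          ((Q.robot i).applyPrim Q.dt n.x p)⟩ : LowNode (Q.robot i)) else s.node b).x =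
          (s.node b).x := fun b => by split_ifs <;> rfl
      simp only [hx]
      exact hs.separated a' b hab hbs
    · intro b hbs
      simp only
      split_ifs with hbb
      · exact ((hb b).1 hbb).2.le.trans (hs.time_le b hbs)
      · exact hs.time_le b hbs

theorem size_le_lowExtend : s.size ≤ (A.lowExtend i δ C n s p).size := by
  rcases A.lowExtend_cases i δ C n s p with ⟨-, h⟩ | ⟨-, -, h⟩ | ⟨-, -, _, -, h⟩ <;> rw [h]
  exact Nat.le_succ _

theorem result_lowExtend : (A.lowExtend i δ C n s p).result = s.result := by
  rcases A.lowExtend_cases i δ C n s p with ⟨-, h⟩ | ⟨-, -, h⟩ | ⟨-, -, _, -, h⟩ <;> rw [h]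

theorem lowExtend_node_x {b : ℕ} (hb : b < s.size) :
    ((A.lowExtend i δ C n s p).node b).x = (s.node b).x := by
  rcases A.lowExtend_cases i δ C n s p with ⟨-, h⟩ | ⟨-, -, h⟩ | ⟨-, -, _, -, h⟩ <;> rw [h]
  · simp only
    rw [Function.update_of_ne hb.ne]
  · simp only
    split_ifs <;> rfl

theorem openSet_subset_lowExtend : s.openSet ⊆ (A.lowExtend i δ C n s p).openSet := by
  rcases A.lowExtend_cases i δ C n s p with ⟨-, h⟩ | ⟨-, -, h⟩ | ⟨-, -, _, -, h⟩ <;> rw [h]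
  · exact Finset.subset_insert _ _
  · exact Finset.subset_union_left

end Planner

open Classical in
/-- The budget of a search that never has more than `D` nodes nor arrival times beyond `G`: it
counts the arrival times that may still be improved and the expansions that are still due. -/
def LowState.budget {R : Robot dw} (D G : ℕ) (s : LowState R) : ℕ :=
  ∑ b ∈ Finset.range D,
    if b < s.size then 2 * (s.node b).g + (if b ∈ s.openSet then 1 else 0) else 2 * G + 2

namespace Planner

variable {Q : Problem dw} {A : Planner Q} {i : Fin Q.N} {B : ℕ} {δ : ℝ}
  {C : List (Constr (Q.robot i))} {s : LowState (Q.robot i)}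
  {n : LowNode (Q.robot i)} {p : (Q.robot i).Prim}

theorem budget_lowExtend_le {D : ℕ} {a : ℕ} (ha : a < s.size) (hna : n.g ≤ a * B)
    (hpB : p.1 ≤ B) :
    (A.lowExtend i δ C n s p).budget D (D * B) ≤ s.budget D (D * B) := by
  refine Finset.sum_le_sum fun b hbD => ?_
  rw [Finset.mem_range] at hbD
  rcases A.lowExtend_cases i δ C n s p with ⟨-, h⟩ | ⟨-, -, h⟩ | ⟨-, -, better, hb, h⟩
  · rw [h]
  · rw [h]
    simp only
    rcases lt_trichotomy b s.size with hlt | rfl | hgt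
    · rw [if_pos (by omega), if_pos hlt, Function.update_of_ne hlt.ne]
      simp [hlt.ne]
    · rw [if_pos (Nat.lt_succ_self _), if_neg (lt_irrefl s.size), Function.update_self]
      simp only [Finset.mem_insert_self, if_true]
      have h1 : n.path.K ≤ a * B := hna
      have h2 : (a + 1) * B ≤ D * B := Nat.mul_le_mul_right _ (by omega)
      simp only [LowNode.g, Traj.append, Robot.applyPrim]
      nlinarith
    · rw [if_neg (by omega), if_neg (by omega)]
  · rw [h]
    simp only
    by_cases hbs : b < s.size
    · rw [if_pos hbs, if_pos hbs]
      by_cases hbb : b ∈ better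
      · have := ((hb b).1 hbb).2
        rw [if_pos hbb, if_pos (Finset.mem_union_right _ hbb)]
        have h3 : LowNode.g ⟨(s.node b).x, n.path.append ((Q.robot i).applyPrim Q.dt n.x p)⟩ =
          (n.path.append ((Q.robot i).applyPrim Q.dt n.x p)).K := rfl
        omega
      · simp [hbb]
    · rw [if_neg hbs, if_neg hbs]

open Classical in
/-- One pass of the loop of a search that is still running. -/
theorem lowStep_cases (M : List (Q.robot i).Prim) (hs : s.result = none) :
    (s.openSet = ∅ ∧ A.lowStep i M δ C s = { s with result := some none }) ∨
    ∃ a ∈ s.openSet,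
      (((Q.robot i).dist (s.node a).x (Q.robot i).goal ≤ δ ∧
          ¬ (s.node a).path.Violates 0 δ C) ∧
        A.lowStep i M δ C s = { s with result := some (some (s.node a).path) }) ∨
      (¬ ((Q.robot i).dist (s.node a).x (Q.robot i).goal ≤ δ ∧
          ¬ (s.node a).path.Violates 0 δ C) ∧
        A.lowStep i M δ C s =
          M.foldl (A.lowExtend i δ C (s.node a)) { s with openSet := s.openSet.erase a }) := by
  by_cases hne : s.openSet.Nonempty
  · right
    have hspec := (s.openSet.exists_min_image
      (fun b => ((s.node b).g : ℝ) + A.h i (s.node b).x) hne).choose_spec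
    refine ⟨_, hspec.1, ?_⟩
    unfold lowStep
    rw [if_neg (by simp [hs]), dif_pos hne]
    simp only
    split_ifs with h
    · exact Or.inl ⟨h, rfl⟩
    · exact Or.inr ⟨h, by congr!⟩
  · left
    refine ⟨Finset.not_nonempty_iff_eq_empty.1 hne, ?_⟩
    unfold lowStep
    rw [if_neg (by simp [hs]), dif_neg hne]

theorem lowStep_of_result_ne (M : List (Q.robot i).Prim) (hs : s.result ≠ none) :
    A.lowStep i M δ C s = s := by
  unfold lowStep
  rw [if_pos hs]

/-- What holds throughout the extension of the popped node `n`. -/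
theorem foldl_lowExtend (hR : (Q.robot i).Regular) (hα : 0 < A.α ∧ A.α < 1) (hδ : 0 < δ)
    (hn : A.NodeOK i δ n) {a D : ℕ} (hna : n.g ≤ a * B) (M : List (Q.robot i).Prim) :
    (∀ p ∈ M, p.Valid Q.dt ∧ p.1 ≤ B) → ∀ s : LowState (Q.robot i), a < s.size →
    A.LowInv i B δ s →
      A.LowInv i B δ (M.foldl (A.lowExtend i δ C n) s) ∧
      (M.foldl (A.lowExtend i δ C n) s).budget D (D * B) ≤ s.budget D (D * B) ∧
      (M.foldl (A.lowExtend i δ C n) s).result = s.result := by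
  induction M with
  | nil => exact fun _ s _ hs => ⟨hs, le_rfl, rfl⟩
  | cons p M ih =>
    intro hM s ha hs
    obtain ⟨hpv, hpB⟩ := hM p List.mem_cons_self
    obtain ⟨h1, h2, h3⟩ := ih (fun q hq => hM q (List.mem_cons_of_mem _ hq))
      (A.lowExtend i δ C n s p) (ha.trans_le size_le_lowExtend)
      (hs.lowExtend hR hα hδ hn ha hna hpv hpB)
    exact ⟨h1, h2.trans (budget_lowExtend_le ha hna hpB), h3.trans result_lowExtend⟩

theorem LowInv.erase (hs : A.LowInv i B δ s) (a : ℕ) :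
    A.LowInv i B δ { s with openSet := s.openSet.erase a } :=
  ⟨fun b hb => hs.open_lt b (Finset.mem_of_mem_erase hb), hs.node_ok, hs.separated, hs.time_le⟩

/-- The invariant and the correctness of the result persist, and each pass costs budget. -/
theorem LowInv.lowStep {D : ℕ} {M : List (Q.robot i).Prim} (hR : (Q.robot i).Regular)
    (hα : 0 < A.α ∧ A.α < 1) (hδ : 0 < δ) (hgoal : (Q.robot i).goal ∈ (Q.robot i).X)
    (hD : ∀ s : LowState (Q.robot i), A.LowInv i B δ s → s.size ≤ D)
    (hM : ∀ p ∈ M, p.Valid Q.dt ∧ p.1 ≤ B) (hs : A.LowInv i B δ s)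
    (hres : ∀ T, s.result = some (some T) → Q.PathOK i (D * B) δ C T) :
    A.LowInv i B δ (A.lowStep i M δ C s) ∧
    (∀ T, (A.lowStep i M δ C s).result = some (some T) → Q.PathOK i (D * B) δ C T) ∧
    ((A.lowStep i M δ C s).result = none →
      (A.lowStep i M δ C s).budget D (D * B) < s.budget D (D * B)) := by
  by_cases hr : s.result = none
  · rcases A.lowStep_cases (δ := δ) (C := C) M hr with ⟨-, h⟩ | ⟨a, ha, ⟨hg, h⟩ | ⟨-, h⟩⟩
    · rw [h]
      exact ⟨⟨hs.open_lt, hs.node_ok, hs.separated, hs.time_le⟩, by simp, by simp⟩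
    · rw [h]
      refine ⟨⟨hs.open_lt, hs.node_ok, hs.separated, hs.time_le⟩, fun T hT => ?_, by simp⟩
      have has := hs.open_lt a ha
      have hok := hs.node_ok a has
      simp only [Option.some.injEq] at hT
      subst hT
      refine ⟨(hs.time_le a has).trans (Nat.mul_le_mul_right _ (has.le.trans (hD s hs))),
        hok.path.discBounded (by linarith) ?_, hg.2⟩
      have := hR.dist_triangle _ (hok.path.free _ le_rfl).1 _ hok.mem _ hgoal
      have h2 := hok.near_end
      have h3 : 0 < A.α * δ := mul_pos hα.1 hδ
      linarith [hg.1]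
    · rw [h]
      have has := hs.open_lt a ha
      obtain ⟨h1, h2, h3⟩ := foldl_lowExtend (C := C) (D := D) hR hα hδ (hs.node_ok a has)
        (hs.time_le a has) M hM { s with openSet := s.openSet.erase a } has (hs.erase a)
      refine ⟨h1, fun T hT => ?_, fun _ => h2.trans_lt ?_⟩
      · rw [h3] at hT
        exact hres T hT
      · refine Finset.sum_lt_sum (fun b _ => ?_)
          ⟨a, Finset.mem_range.2 (has.trans_le (hD s hs)), ?_⟩
        · rcases eq_or_ne b a with rfl | hba
          · simp [has, ha]
          · simp [hba]
        · simp [has, ha]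
  · rw [lowStep_of_result_ne M hr]
    exact ⟨hs, hres, fun h => absurd h hr⟩

theorem exists_forall_size_le (hR : (Q.robot i).Regular) (hα : A.α < 1) (hδ : 0 < δ) :
    ∃ D : ℕ, ∀ s : LowState (Q.robot i), A.LowInv i B δ s → s.size ≤ D := by
  obtain ⟨t, cls, ht, hcls⟩ := hR.exists_finite_classes (mul_pos (sub_pos.2 hα) hδ)
  refine ⟨t.card, fun s hs => ?_⟩
  rw [← Finset.card_range s.size]
  refine Finset.card_le_card_of_injOn (fun b => cls (s.node b).x)
    (fun b hb => ht _ (hs.node_ok b (Finset.mem_range.1 hb)).mem) ?_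
  intro a ha b hb hab
  have ha := Finset.mem_range.1 ha
  have hb := Finset.mem_range.1 hb
  have hxa := (hs.node_ok a ha).mem
  have hxb := (hs.node_ok b hb).mem
  rcases lt_trichotomy a b with h | h | h
  · exact absurd (hcls _ hxa _ hxb hab) (not_le.2 (hs.separated a b h hb))
  · exact h
  · exact absurd (hcls _ hxb _ hxa hab.symm) (not_le.2 (hs.separated b a h ha))

theorem exists_forall_length_le (M : List (Q.robot i).Prim) : ∃ B, ∀ p ∈ M, p.1 ≤ B :=
  ⟨(M.map Sigma.fst).sum, fun _ hp => List.le_sum_of_mem (List.mem_map_of_mem hp)⟩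

variable (A) in
/-- The low-level search terminates, its answers are correct, and the lengths of its paths are
bounded independently of the constraints. -/
theorem exists_dbAstar_eq_some (hR : (Q.robot i).Regular) (hα : 0 < A.α ∧ A.α < 1) (hδ : 0 < δ)
    (hstart : Q.StateFree i (Q.robot i).start) (hgoal : (Q.robot i).goal ∈ (Q.robot i).X)
    {M : List (Q.robot i).Prim} (hM : ∀ p ∈ M, p.Valid Q.dt) :
    ∃ K, ∀ C, ∃ r, A.dbAstar i M δ C = some r ∧ ∀ T, r = some T → Q.PathOK i K δ C T := by
  obtain ⟨B, hB⟩ := exists_forall_length_le M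
  obtain ⟨D, hD⟩ := exists_forall_size_le (A := A) (B := B) hR hα.2 hδ
  refine ⟨D * B, fun C => ?_⟩
  have hMB : ∀ p ∈ M, p.Valid Q.dt ∧ p.1 ≤ B := fun p hp => ⟨hM p hp, hB p hp⟩
  have key : ∀ t, A.LowInv i B δ (A.lowRun i M δ C t) ∧
      (∀ T, (A.lowRun i M δ C t).result = some (some T) → Q.PathOK i (D * B) δ C T) ∧
      ((A.lowRun i M δ C t).result = none →
        (A.lowRun i M δ C t).budget D (D * B) + t ≤ (lowInit i).budget D (D * B)) := by
    intro t
    induction t with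
    | zero => exact ⟨lowInv_init hR hα hδ hstart, by simp [lowRun, lowInit], fun _ => le_rfl⟩
    | succ t ih =>
      obtain ⟨h1, h2, h3⟩ := ih
      obtain ⟨g1, g2, g3⟩ := h1.lowStep hR hα hδ hgoal hD hMB h2
      have hsucc : A.lowRun i M δ C (t + 1) = A.lowStep i M δ C (A.lowRun i M δ C t) :=
        Function.iterate_succ_apply' _ _ _
      rw [hsucc]
      refine ⟨g1, g2, fun hn => ?_⟩
      have hn' : (A.lowRun i M δ C t).result = none := by
        by_contra hcon
        rw [lowStep_of_result_ne M hcon] at hn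
        exact hcon hn
      have := g3 hn
      have := h3 hn'
      omega
  have hterm : ∃ t, (A.lowRun i M δ C t).result ≠ none := by
    by_contra! hcon
    have := (key ((lowInit i).budget D (D * B) + 1)).2.2 (hcon _)
    omega
  obtain ⟨r, hr⟩ := Option.ne_none_iff_exists'.1 (Nat.find_spec hterm)
  refine ⟨r, by rw [dbAstar, dif_pos hterm, hr], fun T hT => ?_⟩
  exact (key _).2.1 T (by rw [hr, hT])

end Planner

/-! ### Success of the low-level search -/

namespace Planner

variable {Q : Problem dw} {A : Planner Q} {i : Fin Q.N} {B : ℕ} {δ : ℝ}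
  {C : List (Constr (Q.robot i))} {s : LowState (Q.robot i)}
  {n : LowNode (Q.robot i)} {p : (Q.robot i).Prim}

variable (A i) in
/-- A primitive that takes the node `n` to the goal in one go and is admitted there. Its end must
be `A.α * δ`-close to the goal: an explored node that absorbs this end is then still `δ`-close. -/
structure LeadsToGoal (δ : ℝ) (C : List (Constr (Q.robot i))) (n : LowNode (Q.robot i))
    (p : (Q.robot i).Prim) : Prop where
  dist_start : (Q.robot i).dist n.x (((Q.robot i).applyPrim Q.dt n.x p).x 0) ≤ A.α * δ
  free : ∀ k ≤ p.1, Q.StateFree i (((Q.robot i).applyPrim Q.dt n.x p).x k)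
  not_violates : ¬ ((Q.robot i).applyPrim Q.dt n.x p).Violates n.g δ C
  dist_goal : (Q.robot i).dist (((Q.robot i).applyPrim Q.dt n.x p).x p.1) (Q.robot i).goal ≤
    A.α * δ

theorem lowExtend_not_violates (hn : ¬ n.path.Violates 0 δ C)
    (hs : ∀ b < s.size, ¬ (s.node b).path.Violates 0 δ C) :
    ∀ b < (A.lowExtend i δ C n s p).size,
      ¬ ((A.lowExtend i δ C n s p).node b).path.Violates 0 δ C := by
  intro b
  rcases A.lowExtend_cases i δ C n s p with ⟨-, h⟩ | ⟨hok, -, h⟩ | ⟨hok, -, better, hb, h⟩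
  · rw [h]
    exact hs b
  · rw [h]
    intro hbs
    simp only at hbs ⊢
    rcases eq_or_ne b s.size with rfl | hne
    · rw [Function.update_self]
      exact fun hv => hv.append.elim hn hok.2.2
    · rw [Function.update_of_ne hne]
      exact hs b (by omega)
  · rw [h]
    intro hbs
    simp only
    split_ifs
    · exact fun hv => hv.append.elim hn hok.2.2
    · exact hs b hbs

theorem lowExtend_mem_openSet {P : (Q.robot i).State → Prop}
    (hs : ∀ b < s.size, P (s.node b).x → b ∈ s.openSet) :
    ∀ b < (A.lowExtend i δ C n s p).size, P ((A.lowExtend i δ C n s p).node b).x →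
      b ∈ (A.lowExtend i δ C n s p).openSet := by
  intro b hb hP
  by_cases hbs : b < s.size
  · rw [lowExtend_node_x hbs] at hP
    exact openSet_subset_lowExtend (hs b hbs hP)
  · rcases A.lowExtend_cases i δ C n s p with ⟨-, h⟩ | ⟨-, -, h⟩ | ⟨-, -, _, -, h⟩ <;>
      rw [h] at hb ⊢
    · exact absurd hb hbs
    · obtain rfl : b = s.size := by simp only at hb; omega
      exact Finset.mem_insert_self _ _
    · exact absurd hb hbs

theorem lowExtend_exists {P : (Q.robot i).State → Prop} (hs : ∃ b < s.size, P (s.node b).x) :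
    ∃ b < (A.lowExtend i δ C n s p).size, P ((A.lowExtend i δ C n s p).node b).x := by
  obtain ⟨b, hb, hP⟩ := hs
  exact ⟨b, hb.trans_le size_le_lowExtend, by rwa [lowExtend_node_x hb]⟩

theorem LeadsToGoal.exists_near_goal (hp : A.LeadsToGoal i δ C n p) (hR : (Q.robot i).Regular)
    (hα : A.α < 1) (hδ : 0 < δ) (hgoal : (Q.robot i).goal ∈ (Q.robot i).X)
    (hs : A.LowInv i B δ s) :
    ∃ b < (A.lowExtend i δ C n s p).size,
      (Q.robot i).dist ((A.lowExtend i δ C n s p).node b).x (Q.robot i).goal ≤ δ := by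
  rcases A.lowExtend_cases i δ C n s p with ⟨hok, -⟩ | ⟨-, -, h⟩ | ⟨-, ⟨b, hb, hbd⟩, -⟩
  · exact absurd ⟨hp.dist_start, hp.free, hp.not_violates⟩ hok
  · refine ⟨s.size, by rw [h]; exact Nat.lt_succ_self _, ?_⟩
    rw [h]
    simp only [Function.update_self]
    exact hp.dist_goal.trans (by nlinarith)
  · refine ⟨b, hb.trans_le size_le_lowExtend, ?_⟩
    rw [lowExtend_node_x hb]
    have h1 := hR.dist_triangle _ (hs.node_ok b hb).mem _ (hp.free p.1 le_rfl).1 _ hgoal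
    have h2 := hp.dist_goal
    have h3 : (Q.robot i).dist (s.node b).x (((Q.robot i).applyPrim Q.dt n.x p).x p.1) ≤
      (1 - A.α) * δ := hbd
    linarith

variable (A i) in
/-- A search that cannot fail any more: its paths obey the constraints, and it has a node close to
the goal, which is still to be popped (all such nodes are open, since popping one of them ends the
search). -/
structure Promising (B : ℕ) (δ : ℝ) (C : List (Constr (Q.robot i))) (s : LowState (Q.robot i)) :
    Prop where
  inv : A.LowInv i B δ s
  not_violates : ∀ b < s.size, ¬ (s.node b).path.Violates 0 δ C
  mem_open : ∀ b < s.size, (Q.robot i).dist (s.node b).x (Q.robot i).goal ≤ δ → b ∈ s.openSet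
  exists_near : ∃ b < s.size, (Q.robot i).dist (s.node b).x (Q.robot i).goal ≤ δ

/-- Extending a node by a list of primitives makes the search promising if one of these leads to
the goal. -/
theorem promising_foldl_lowExtend (hR : (Q.robot i).Regular) (hα : 0 < A.α ∧ A.α < 1) (hδ : 0 < δ)
    (hgoal : (Q.robot i).goal ∈ (Q.robot i).X)
    (hn : A.NodeOK i δ n) (hnv : ¬ n.path.Violates 0 δ C) {a : ℕ} (hna : n.g ≤ a * B)
    (M : List (Q.robot i).Prim) :
    (∀ p ∈ M, p.Valid Q.dt ∧ p.1 ≤ B) → ∀ s : LowState (Q.robot i), a < s.size →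
    A.LowInv i B δ s → (∀ b < s.size, ¬ (s.node b).path.Violates 0 δ C) →
    (∀ b < s.size, (Q.robot i).dist (s.node b).x (Q.robot i).goal ≤ δ → b ∈ s.openSet) →
    ((∃ b < s.size, (Q.robot i).dist (s.node b).x (Q.robot i).goal ≤ δ) ∨
      ∃ p ∈ M, A.LeadsToGoal i δ C n p) →
      A.Promising i B δ C (M.foldl (A.lowExtend i δ C n) s) := by
  induction M with
  | nil => exact fun _ s _ h1 h2 h3 h4 => ⟨h1, h2, h3, h4.resolve_right (by simp)⟩
  | cons p M ih =>
    intro hM s ha h1 h2 h3 h4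
    obtain ⟨hpv, hpB⟩ := hM p List.mem_cons_self
    refine ih (fun q hq => hM q (List.mem_cons_of_mem _ hq)) (A.lowExtend i δ C n s p)
      (ha.trans_le size_le_lowExtend) (h1.lowExtend hR hα hδ hn ha hna hpv hpB)
      (lowExtend_not_violates hnv h2)
      (lowExtend_mem_openSet (P := fun x => (Q.robot i).dist x (Q.robot i).goal ≤ δ) h3) ?_
    rcases h4 with h4 | ⟨q, hq, hqg⟩
    · exact Or.inl
        (lowExtend_exists (P := fun x => (Q.robot i).dist x (Q.robot i).goal ≤ δ) h4)
    · rcases List.mem_cons.1 hq with rfl | hq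
      · exact Or.inl (hqg.exists_near_goal hR hα.2 hδ hgoal h1)
      · exact Or.inr ⟨q, hq, hqg⟩

/-- One pass on a running search that is promising, or whose first popped node has a primitive
leading to the goal, finds a path or leaves a promising search. -/
theorem lowStep_promising {M : List (Q.robot i).Prim} (hR : (Q.robot i).Regular)
    (hα : 0 < A.α ∧ A.α < 1) (hδ : 0 < δ) (hgoal : (Q.robot i).goal ∈ (Q.robot i).X)
    (hM : ∀ p ∈ M, p.Valid Q.dt ∧ p.1 ≤ B) (hr : s.result = none) (h1 : A.LowInv i B δ s)
    (h2 : ∀ b < s.size, ¬ (s.node b).path.Violates 0 δ C)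
    (h3 : ∀ b < s.size, (Q.robot i).dist (s.node b).x (Q.robot i).goal ≤ δ → b ∈ s.openSet)
    (hne : s.openSet.Nonempty)
    (h4 : (∃ b < s.size, (Q.robot i).dist (s.node b).x (Q.robot i).goal ≤ δ) ∨
      ∀ a ∈ s.openSet, ∃ p ∈ M, A.LeadsToGoal i δ C (s.node a) p) :
    (∃ T, (A.lowStep i M δ C s).result = some (some T)) ∨
      ((A.lowStep i M δ C s).result = none ∧ A.Promising i B δ C (A.lowStep i M δ C s)) := by
  rcases A.lowStep_cases (δ := δ) (C := C) M hr with ⟨hemp, -⟩ | ⟨a, ha, ⟨hg, h⟩ | ⟨hg, h⟩⟩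
  · exact absurd hemp hne.ne_empty
  · exact Or.inl ⟨_, by rw [h]⟩
  · right
    have has := h1.open_lt a ha
    have hfar : ¬ (Q.robot i).dist (s.node a).x (Q.robot i).goal ≤ δ := fun hc =>
      hg ⟨hc, h2 a has⟩
    rw [h]
    constructor
    · rw [(foldl_lowExtend (D := 0) hR hα hδ (h1.node_ok a has) (h1.time_le a has) M hM
        { s with openSet := s.openSet.erase a } has (h1.erase a)).2.2]
      exact hr
    · refine promising_foldl_lowExtend hR hα hδ hgoal (h1.node_ok a has) (h2 a has)
        (h1.time_le a has) M hM _ has (h1.erase a) h2 (fun b hb hbd => ?_)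
        (h4.imp_right fun h => h a ha)
      refine Finset.mem_erase.2 ⟨?_, h3 b hb hbd⟩
      rintro rfl
      exact hfar hbd

variable (A) in
/-- The low-level search succeeds if a single primitive leads from the start to the goal. Only such
primitives are of use for completeness: a longer chain of primitives could be spoilt by the search
keeping just the earliest arrival at each node, which may be incompatible with the constraints. -/
theorem exists_dbAstar_eq_some_some (hR : (Q.robot i).Regular) (hα : 0 < A.α ∧ A.α < 1)
    (hδ : 0 < δ) (hstart : Q.StateFree i (Q.robot i).start)
    (hgoal : (Q.robot i).goal ∈ (Q.robot i).X)
    {M : List (Q.robot i).Prim} (hM : ∀ p ∈ M, p.Valid Q.dt)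
    (hC : ∀ c ∈ C, c.time = 0 → δ < (Q.robot i).dist (Q.robot i).start c.state)
    (hlead : (Q.robot i).dist (Q.robot i).start (Q.robot i).goal ≤ δ ∨
      ∃ p ∈ M, A.LeadsToGoal i δ C ((lowInit i).node 0) p) :
    ∃ T, A.dbAstar i M δ C = some (some T) := by
  obtain ⟨B, hB⟩ := exists_forall_length_le M
  have hMB : ∀ p ∈ M, p.Valid Q.dt ∧ p.1 ≤ B := fun p hp => ⟨hM p hp, hB p hp⟩
  have hinv := lowInv_init (B := B) hR hα hδ hstart
  have hviol : ∀ b < (lowInit i).size, ¬ ((lowInit i).node b).path.Violates 0 δ C := by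
    rintro b - ⟨c, hc, -, h2, h3⟩
    exact absurd h3 (not_le.2 (hC c hc (by simpa [lowInit] using h2)))
  have hopen : ∀ b < (lowInit i).size,
      (Q.robot i).dist ((lowInit i).node b).x (Q.robot i).goal ≤ δ →
      b ∈ (lowInit i).openSet := fun b hb _ => by simpa [lowInit] using hb
  have key : ∀ t, (∃ T, (A.lowRun i M δ C (t + 1)).result = some (some T)) ∨
      ((A.lowRun i M δ C (t + 1)).result = none ∧
        A.Promising i B δ C (A.lowRun i M δ C (t + 1))) := by
    intro t
    induction t with
    | zero =>
      refine lowStep_promising hR hα hδ hgoal hMB rfl hinv hviol hopen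
        ⟨0, Finset.mem_singleton_self 0⟩ ?_
      rcases hlead with h | h
      · exact Or.inl ⟨0, Nat.zero_lt_one, h⟩
      · refine Or.inr fun a ha => ?_
        obtain rfl : a = 0 := Finset.mem_singleton.1 ha
        exact h
    | succ t ih =>
      rw [show A.lowRun i M δ C (t + 1 + 1) = A.lowStep i M δ C (A.lowRun i M δ C (t + 1)) from
        Function.iterate_succ_apply' _ _ _]
      rcases ih with ⟨T, hT⟩ | ⟨hr, hp⟩
      · exact Or.inl ⟨T, by rw [lowStep_of_result_ne M (by simp [hT]), hT]⟩
      · obtain ⟨b, hb, hbd⟩ := hp.exists_near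
        exact lowStep_promising hR hα hδ hgoal hMB hr hp.inv hp.not_violates hp.mem_open
          ⟨b, hp.mem_open b hb hbd⟩ (Or.inl hp.exists_near)
  obtain ⟨K, hK⟩ := A.exists_dbAstar_eq_some hR hα hδ hstart hgoal hM
  obtain ⟨r, hr, -⟩ := hK C
  unfold dbAstar at hr ⊢
  split_ifs at hr ⊢ with ht
  rcases hfind : Nat.find ht with _ | t
  · exact absurd (show (A.lowRun i M δ C (Nat.find ht)).result = none by rw [hfind]; rfl)
      (Nat.find_spec ht)
  · rcases key t with hT | ⟨hnone, -⟩
    · exact hT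
    · exact absurd hnone (hfind ▸ Nat.find_spec ht)

end Planner

/-! ### Termination of the high-level search -/

theorem Problem.not_conflict_of_earliestConflict_eq_none {Q : Problem dw} {Y : Q.Joint}
    (h : Q.earliestConflict Y = none) (i j : Fin Q.N) (k : ℕ) : ¬ Q.Conflict Y i j k := by
  intro hc
  unfold earliestConflict at h
  rw [dif_pos ⟨k, (i, j), hc⟩] at h
  simp at h

open Classical in
theorem Problem.conflict_of_earliestConflict_eq_some {Q : Problem dw} {Y : Q.Joint}
    {i j : Fin Q.N} {k : ℕ} (h : Q.earliestConflict Y = some (i, j, k)) : Q.Conflict Y i j k := by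
  unfold earliestConflict at h
  split_ifs at h with hc
  have hspec := (Nat.find_spec hc).choose_spec
  simp only [Option.some.injEq, Prod.mk.injEq] at h
  obtain ⟨rfl, rfl, rfl⟩ := h
  exact hspec

/-- A node of the constraint tree whose paths obey its constraints. The constraints of a robot that
concern the same time are `δ`-separated, since each of them was taken from a path that obeyed the
previous ones. -/
structure HighNode.OK {Q : Problem dw} (K : Fin Q.N → ℕ) (δ : ℝ) (P : HighNode Q) : Prop where
  path : ∀ c, Q.PathOK c (K c) δ (P.constraints c) (P.solution c)
  constr : ∀ c, ∀ e ∈ P.constraints c, e.state ∈ (Q.robot c).X ∧ e.time ≤ K c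
  separated : ∀ c, (P.constraints c).Pairwise fun e e' =>
    e.time = e'.time → δ < (Q.robot c).dist e.state e'.state

/-- The depth of a node in the constraint tree. -/
def HighNode.depth {Q : Problem dw} (P : HighNode Q) : ℕ := ∑ c, (P.constraints c).length

theorem HighNode.exists_forall_depth_le {Q : Problem dw} (hreg : ∀ i, (Q.robot i).Regular)
    (K : Fin Q.N → ℕ) {δ : ℝ} (hδ : 0 < δ) : ∃ n, ∀ P : HighNode Q, P.OK K δ → P.depth ≤ n := by
  have hc : ∀ c, ∃ n, ∀ P : HighNode Q, P.OK K δ → (P.constraints c).length ≤ n := by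
    intro c
    classical
    obtain ⟨t, cls, ht, hcls⟩ := (hreg c).exists_finite_classes hδ
    refine ⟨(t ×ˢ Finset.range (K c + 1)).card, fun P hP => ?_⟩
    set g : Constr (Q.robot c) → (Q.robot c).State × ℕ := fun e => (cls e.state, e.time)
    have hnd : ((P.constraints c).map g).Nodup := by
      refine List.pairwise_map.2 ((hP.separated c).imp_of_mem fun {e e'} he he' hsep heq => ?_)
      obtain ⟨h1, h2⟩ := Prod.mk.inj heq
      exact absurd (hcls _ (hP.constr c e he).1 _ (hP.constr c e' he').1 h1)
        (not_le.2 (hsep h2))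
    rw [← List.length_map (f := g), ← List.toFinset_card_of_nodup hnd]
    refine Finset.card_le_card fun z hz => ?_
    obtain ⟨e, he, rfl⟩ := List.mem_map.1 (List.mem_toFinset.1 hz)
    have := hP.constr c e he
    exact Finset.mem_product.2 ⟨ht _ this.1, Finset.mem_range.2 (Nat.lt_succ_of_le this.2)⟩
  choose n hn using hc
  exact ⟨∑ c, n c, fun P hP => Finset.sum_le_sum fun c _ => hn c P hP⟩

namespace Planner

variable {Q : Problem dw} {A : Planner Q} {M : ∀ i, List (Q.robot i).Prim} {δ : ℝ}
  {K : Fin Q.N → ℕ} {P : HighNode Q} {s : HighState Q}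

variable (A M δ K) in
/-- All low-level searches terminate with correct answers; the bound on the path lengths of a robot
is uniform in the constraints. -/
def LowLevelOK : Prop :=
  ∀ c C, ∃ r, A.dbAstar c (M c) δ C = some r ∧ ∀ T, r = some T → Q.PathOK c (K c) δ C T

theorem exists_child_eq_some (hlow : A.LowLevelOK M δ K) (hP : P.OK K δ) {c : Fin Q.N} {k : ℕ}
    (hk : k ≤ (P.solution c).K) :
    ∃ l, A.child M δ P c k = some l ∧ l.length ≤ 1 ∧
      (∀ P' ∈ l, P'.OK K δ ∧ P'.depth = P.depth + 1 ∧ P'.constraints =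
        Function.update P.constraints c (⟨(P.solution c).x k, k⟩ :: P.constraints c)) ∧
      ((∃ T, A.dbAstar c (M c) δ (⟨(P.solution c).x k, k⟩ :: P.constraints c) =
        some (some T)) → ∃ P', P' ∈ l) := by
  obtain ⟨r, hr, hrT⟩ := hlow c (⟨(P.solution c).x k, k⟩ :: P.constraints c)
  cases r with
  | none =>
    refine ⟨[], ?_, by simp, by simp, ?_⟩
    · simp only [child, Function.update_self, hr]
    · rintro ⟨T, hT⟩
      rw [hr] at hT
      simp at hT
  | some T =>
    refine ⟨[⟨Function.update P.solution c T, Function.update P.constraints c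
      (⟨(P.solution c).x k, k⟩ :: P.constraints c)⟩], ?_, by simp, ?_,
      fun _ => ⟨_, List.mem_singleton_self _⟩⟩
    · simp only [child, Function.update_self, hr]
    · intro P' hP'
      obtain rfl := List.mem_singleton.1 hP'
      refine ⟨⟨fun a => ?_, fun a => ?_, fun a => ?_⟩, ?_, rfl⟩
      · rcases eq_or_ne a c with rfl | hne
        · simpa only [Function.update_self] using hrT T rfl
        · simpa only [Function.update_of_ne hne] using hP.path a
      · rcases eq_or_ne a c with rfl | hne
        · simp only [Function.update_self]
          intro e he
          rcases List.mem_cons.1 he with rfl | he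
          · exact ⟨((hP.path a).discBounded.free k hk).1, hk.trans (hP.path a).length_le⟩
          · exact hP.constr a e he
        · simpa only [Function.update_of_ne hne] using hP.constr a
      · rcases eq_or_ne a c with rfl | hne
        · simp only [Function.update_self]
          refine List.pairwise_cons.2 ⟨fun e he hke => ?_, hP.separated a⟩
          by_contra hcon
          simp only at hke hcon
          refine (hP.path a).not_violates ⟨e, he, Nat.zero_le _, by omega, ?_⟩
          rw [← hke]
          exact not_lt.1 hcon
        · simpa only [Function.update_of_ne hne] using hP.separated a
      · simp only [HighNode.depth]
        rw [← Finset.add_sum_erase _ _ (Finset.mem_univ c),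
          ← Finset.add_sum_erase _ (fun a => (P.constraints a).length) (Finset.mem_univ c)]
        rw [Finset.sum_congr rfl fun a ha => by
          rw [Function.update_of_ne (Finset.ne_of_mem_erase ha)]]
        simp only [Function.update_self, List.length_cons]
        omega

open Classical in
/-- One pass of the loop on a nonempty queue. -/
theorem highStep_cases (hlow : A.LowLevelOK M δ K) (hs : ∀ P ∈ s.openList, P.OK K δ)
    (hne : s.openList ≠ []) :
    ∃ P ∈ s.openList,
      ((∀ i j k, ¬ Q.Conflict P.solution i j k) ∧
        A.highStep M δ s = ⟨s.openList.erase P, (A.opt P.solution).toList ++ s.reports⟩) ∨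
      ∃ i j k l l', Q.Conflict P.solution i j k ∧
        A.child M δ P i k = some l ∧ A.child M δ P j k = some l' ∧
        A.highStep M δ s = ⟨s.openList.erase P ++ l ++ l', s.reports⟩ := by
  obtain ⟨P, hP⟩ := Option.ne_none_iff_exists'.1 (mt List.argmin_eq_none.1 hne :
    s.openList.argmin HighNode.cost ≠ none)
  have hmem : P ∈ s.openList := List.argmin_mem hP
  refine ⟨P, hmem, ?_⟩
  rcases he : Q.earliestConflict P.solution with _ | ⟨i, j, k⟩
  · refine Or.inl ⟨Q.not_conflict_of_earliestConflict_eq_none he, ?_⟩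
    simp only [highStep, hP, he]
  · have hc := Q.conflict_of_earliestConflict_eq_some he
    obtain ⟨l, hl, -⟩ := exists_child_eq_some hlow (hs P hmem) hc.2.1
    obtain ⟨l', hl', -⟩ := exists_child_eq_some hlow (hs P hmem) hc.2.2.1
    refine Or.inr ⟨i, j, k, l, l', hc, hl, hl', ?_⟩
    simp only [highStep, hP, he, hl, hl']

open Classical in
theorem highStep_ok (hlow : A.LowLevelOK M δ K) (hs : ∀ P ∈ s.openList, P.OK K δ) :
    ∀ P ∈ (A.highStep M δ s).openList, P.OK K δ := by
  by_cases hne : s.openList = []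
  · have : A.highStep M δ s = s := by simp [highStep, hne]
    rwa [this]
  · obtain ⟨P, hP, ⟨-, h⟩ | ⟨i, j, k, l, l', hc, hl, hl', h⟩⟩ := highStep_cases hlow hs hne
    · rw [h]
      exact fun P' hP' => hs P' (List.mem_of_mem_erase hP')
    · obtain ⟨_, hl₁, -, h₁, -⟩ := exists_child_eq_some hlow (hs P hP) hc.2.1
      obtain ⟨_, hl₂, -, h₂, -⟩ := exists_child_eq_some hlow (hs P hP) hc.2.2.1
      obtain rfl := Option.some.inj (hl.symm.trans hl₁)
      obtain rfl := Option.some.inj (hl'.symm.trans hl₂)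
      rw [h]
      intro P' hP'
      rcases List.mem_append.1 hP' with hP' | hP'
      · rcases List.mem_append.1 hP' with hP' | hP'
        · exact hs P' (List.mem_of_mem_erase hP')
        · exact (h₁ P' hP').1
      · exact (h₂ P' hP').1

theorem iterate_highStep_ok (hlow : A.LowLevelOK M δ K) (hs : ∀ P ∈ s.openList, P.OK K δ)
    (t : ℕ) : ∀ P ∈ ((A.highStep M δ)^[t] s).openList, P.OK K δ := by
  induction t with
  | zero => exact hs
  | succ t ih =>
    rw [Function.iterate_succ_apply']
    exact highStep_ok hlow ih

/-- Two children of a node together weigh less than the node. -/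
theorem sum_weight_highStep_lt {n : ℕ} (hn : ∀ P : HighNode Q, P.OK K δ → P.depth ≤ n)
    (hlow : A.LowLevelOK M δ K) (hs : ∀ P ∈ s.openList, P.OK K δ) (hne : s.openList ≠ []) :
    ((A.highStep M δ s).openList.map fun P => 3 ^ (n - P.depth)).sum <
      (s.openList.map fun P => 3 ^ (n - P.depth)).sum := by
  classical
  have hchild : ∀ (P : HighNode Q) (l : List (HighNode Q)), l.length ≤ 1 →
      (∀ P' ∈ l, P'.OK K δ ∧ P'.depth = P.depth + 1) →
      3 * (l.map fun P => 3 ^ (n - P.depth)).sum ≤ 3 ^ (n - P.depth) := by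
    intro P l hl h
    match l, hl with
    | [], _ => simp
    | [P'], _ =>
      obtain ⟨h1, h2⟩ := h P' (by simp)
      have h3 := hn P' h1
      rw [show n - P.depth = n - P'.depth + 1 by omega, pow_succ]
      simp [mul_comm]
    | _ :: _ :: _, hl => simp at hl
  obtain ⟨P, hP, ⟨-, h⟩ | ⟨i, j, k, l, l', hc, hl, hl', h⟩⟩ := highStep_cases hlow hs hne
  · rw [h, ← List.sum_map_erase (fun P : HighNode Q => 3 ^ (n - P.depth)) hP]
    have : 0 < 3 ^ (n - P.depth) := by positivity
    convert Nat.lt_add_of_pos_left this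
  · obtain ⟨_, hl₁, k₁, h₁, -⟩ := exists_child_eq_some hlow (hs P hP) hc.2.1
    obtain ⟨_, hl₂, k₂, h₂, -⟩ := exists_child_eq_some hlow (hs P hP) hc.2.2.1
    obtain rfl := Option.some.inj (hl.symm.trans hl₁)
    obtain rfl := Option.some.inj (hl'.symm.trans hl₂)
    have g₁ := hchild P l k₁ fun P' hP' => ⟨(h₁ P' hP').1, (h₁ P' hP').2.1⟩
    have g₂ := hchild P l' k₂ fun P' hP' => ⟨(h₂ P' hP').1, (h₂ P' hP').2.1⟩
    rw [h, ← List.sum_map_erase (fun P : HighNode Q => 3 ^ (n - P.depth)) hP]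
    simp only [List.map_append, List.sum_append]
    have : 0 < 3 ^ (n - P.depth) := by positivity
    omega

theorem exists_openList_eq_nil (hreg : ∀ i, (Q.robot i).Regular) (hδ : 0 < δ)
    (hlow : A.LowLevelOK M δ K) (hs : ∀ P ∈ s.openList, P.OK K δ) :
    ∃ t, ((A.highStep M δ)^[t] s).openList = [] := by
  obtain ⟨n, hn⟩ := HighNode.exists_forall_depth_le hreg K hδ
  by_contra! hcon
  have key : ∀ t, (((A.highStep M δ)^[t] s).openList.map fun P => 3 ^ (n - P.depth)).sum + t ≤
      (s.openList.map fun P => 3 ^ (n - P.depth)).sum := by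
    intro t
    induction t with
    | zero => exact le_rfl
    | succ t ih =>
      have := sum_weight_highStep_lt hn hlow (iterate_highStep_ok hlow hs t) (hcon t)
      rw [Function.iterate_succ_apply']
      omega
  have := key ((s.openList.map fun P => 3 ^ (n - P.depth)).sum + 1)
  omega

/-- The search starts with an empty queue, or with a root without constraints if all robots have
paths. -/
theorem exists_highInit_eq_some (hlow : A.LowLevelOK M δ K) :
    ∃ s, A.highInit M δ = some s ∧ (∀ P ∈ s.openList, P.OK K δ) ∧
      ((∀ i, ∃ T, A.dbAstar i (M i) δ [] = some (some T)) →
        ∃ P ∈ s.openList, ∀ c, P.constraints c = []) := by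
  have h0 : ¬ ∃ i, A.dbAstar i (M i) δ [] = none := by
    rintro ⟨i, hi⟩
    obtain ⟨r, hr, -⟩ := hlow i []
    rw [hi] at hr
    simp at hr
  unfold highInit
  rw [if_neg h0]
  split_ifs with hY
  · refine ⟨_, rfl, fun P hP => ?_, fun _ => ⟨_, List.mem_singleton_self _, fun _ => rfl⟩⟩
    obtain rfl := List.mem_singleton.1 hP
    refine ⟨fun c => ?_, by simp, by simp⟩
    obtain ⟨r, hr, hrT⟩ := hlow c []
    exact hrT _ (Option.some.inj (hr.symm.trans (hY.choose_spec c)))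
  · refine ⟨_, rfl, by simp, fun h => absurd ?_ hY⟩
    choose Y hY using h
    exact ⟨Y, hY⟩

variable (A) in
theorem exists_lowLevelOK (hreg : ∀ i, (Q.robot i).Regular) (hα : 0 < A.α ∧ A.α < 1) (hδ : 0 < δ)
    (hstart : ∀ i, Q.StateFree i (Q.robot i).start)
    (hgoal : ∀ i, (Q.robot i).goal ∈ (Q.robot i).X)
    (hM : ∀ i, ∀ p ∈ M i, p.Valid Q.dt) : ∃ K, A.LowLevelOK M δ K := by
  choose K hK using fun i =>
    A.exists_dbAstar_eq_some (hreg i) hα hδ (hstart i) (hgoal i) (hM i)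
  exact ⟨K, hK⟩

variable (A) in
theorem terminates (hreg : ∀ i, (Q.robot i).Regular) (hα : 0 < A.α ∧ A.α < 1) (hδ : 0 < δ)
    (hstart : ∀ i, Q.StateFree i (Q.robot i).start)
    (hgoal : ∀ i, (Q.robot i).goal ∈ (Q.robot i).X)
    (hM : ∀ i, ∀ p ∈ M i, p.Valid Q.dt) : A.Terminates M δ := by
  obtain ⟨K, hlow⟩ := A.exists_lowLevelOK hreg hα hδ hstart hgoal hM
  obtain ⟨s, hs, hok, -⟩ := exists_highInit_eq_some hlow
  exact ⟨s, hs, exists_openList_eq_nil hreg hδ hlow hok⟩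

/-! ### Success of the high-level search -/

/-- The constraints `C` on robot `c` stay away from the reference trajectory `S`. -/
def ConstrAvoid (S : Q.Joint) (ε : ℝ) (c : Fin Q.N) (C : List (Constr (Q.robot c))) : Prop :=
  ∀ e ∈ C, e.state ∈ (Q.robot c).X ∧
    (e.time ≤ (S c).K → ε < (Q.robot c).dist ((S c).x e.time) e.state)

/-- If the states of two paths collide, then one of them is far from a reference trajectory with
clearance, and the constraint derived from it does not concern that trajectory. -/
theorem constrAvoid_cons_or {S : Q.Joint} {ε : ℝ} (hcl : Q.HasClearance S ε) (hP : P.OK K δ)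
    (hav : ∀ c, ConstrAvoid S ε c (P.constraints c)) {i j : Fin Q.N} {k : ℕ}
    (hc : Q.Conflict P.solution i j k) :
    ConstrAvoid S ε i (⟨(P.solution i).x k, k⟩ :: P.constraints i) ∨
    ConstrAvoid S ε j (⟨(P.solution j).x k, k⟩ :: P.constraints j) := by
  have key : ∀ c, k ≤ (P.solution c).K →
      (k ≤ (S c).K → ε < (Q.robot c).dist ((S c).x k) ((P.solution c).x k)) →
      ConstrAvoid S ε c (⟨(P.solution c).x k, k⟩ :: P.constraints c) := by
    intro c hk h e he
    rcases List.mem_cons.1 he with rfl | he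
    · exact ⟨((hP.path c).discBounded.free k hk).1, h⟩
    · exact hav c e he
  obtain ⟨hij, hi, hj, hcol⟩ := hc
  by_contra! hcon
  have hi' := mt (key i hi) hcon.1
  have hj' := mt (key j hj) hcon.2
  push Not at hi' hj'
  exact hcol (hcl.robots i j hij k hi'.1 hj'.1 _ ((hP.path i).discBounded.free k hi).1 hi'.2 _
    ((hP.path j).discBounded.free k hj).1 hj'.2)

/-- A solution has been reported, or a node with constraints that do not concern the reference
trajectory is waiting. -/
theorem highStep_reports_or {S : Q.Joint} {ε : ℝ} (hlow : A.LowLevelOK M δ K)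
    (hcl : Q.HasClearance S ε)
    (hopt : ∀ Y : Q.Joint, (∀ i, Q.DiscBounded i (2 * δ) (Y i)) →
      (∀ i j k, ¬ Q.Conflict Y i j k) → ∃ S, A.opt Y = some S ∧ Q.IsSolution S)
    (hlead : ∀ c C, ConstrAvoid S ε c C → ∃ T, A.dbAstar c (M c) δ C = some (some T))
    (hs : ∀ P ∈ s.openList, P.OK K δ)
    (h : (∃ S ∈ s.reports, Q.IsSolution S) ∨
      ∃ P ∈ s.openList, ∀ c, ConstrAvoid S ε c (P.constraints c)) :
    (∃ S ∈ (A.highStep M δ s).reports, Q.IsSolution S) ∨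
      ∃ P ∈ (A.highStep M δ s).openList, ∀ c, ConstrAvoid S ε c (P.constraints c) := by
  classical
  by_cases hne : s.openList = []
  · have : A.highStep M δ s = s := by simp [highStep, hne]
    rwa [this]
  obtain ⟨P, hP, ⟨hno, hst⟩ | ⟨i, j, k, l, l', hc, hl, hl', hst⟩⟩ := highStep_cases hlow hs hne
  · rw [hst]
    rcases h with ⟨S', hS', hsol⟩ | ⟨P', hP', hav⟩
    · exact Or.inl ⟨S', List.mem_append_right _ hS', hsol⟩
    · rcases eq_or_ne P' P with rfl | hPP
      · obtain ⟨S', hS', hsol⟩ := hopt _ (fun i => ((hs P' hP).path i).discBounded) hno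
        exact Or.inl ⟨S', List.mem_append_left _ (by simp [hS']), hsol⟩
      · exact Or.inr ⟨P', by convert (List.mem_erase_of_ne hPP).2 hP', hav⟩
  · rw [hst]
    refine h.imp id ?_
    rintro ⟨P', hP', hav⟩
    rcases eq_or_ne P' P with rfl | hPP
    · have hchild : ∀ c l, k ≤ (P'.solution c).K → A.child M δ P' c k = some l →
          ConstrAvoid S ε c (⟨(P'.solution c).x k, k⟩ :: P'.constraints c) →
          ∃ P'' ∈ l, ∀ c, ConstrAvoid S ε c (P''.constraints c) := by
        intro c l hk hl hcav
        obtain ⟨_, hl₁, -, h₁, h₂⟩ := exists_child_eq_some hlow (hs P' hP) hk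
        obtain rfl := Option.some.inj (hl.symm.trans hl₁)
        obtain ⟨P'', hP''⟩ := h₂ (hlead c _ hcav)
        refine ⟨P'', hP'', fun a => ?_⟩
        rw [(h₁ P'' hP'').2.2]
        rcases eq_or_ne a c with rfl | hac
        · rwa [Function.update_self]
        · rw [Function.update_of_ne hac]
          exact hav a
      rcases constrAvoid_cons_or hcl (hs P' hP) hav hc with hcav | hcav
      · obtain ⟨P'', hP'', h''⟩ := hchild i l hc.2.1 hl hcav
        exact ⟨P'', List.mem_append_left _ (List.mem_append_right _ hP''), h''⟩
      · obtain ⟨P'', hP'', h''⟩ := hchild j l' hc.2.2.1 hl' hcav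
        exact ⟨P'', List.mem_append_right _ hP'', h''⟩
    · refine ⟨P', List.mem_append_left _ (List.mem_append_left _ ?_), hav⟩
      convert (List.mem_erase_of_ne hPP).2 hP'

/-- An iteration reports a solution if each low-level search succeeds whose constraints stay away
from a solution with clearance. -/
theorem reportsSolution {S : Q.Joint} {ε : ℝ} (hreg : ∀ i, (Q.robot i).Regular) (hδ : 0 < δ)
    (hlow : A.LowLevelOK M δ K) (hcl : Q.HasClearance S ε)
    (hopt : ∀ Y : Q.Joint, (∀ i, Q.DiscBounded i (2 * δ) (Y i)) →
      (∀ i j k, ¬ Q.Conflict Y i j k) → ∃ S, A.opt Y = some S ∧ Q.IsSolution S)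
    (hlead : ∀ c C, ConstrAvoid S ε c C → ∃ T, A.dbAstar c (M c) δ C = some (some T)) :
    A.ReportsSolution M δ := by
  obtain ⟨s, hs, hok, hroot⟩ := exists_highInit_eq_some hlow
  obtain ⟨t, ht⟩ := exists_openList_eq_nil hreg hδ hlow hok
  refine ⟨s, hs, t, ?_⟩
  have key : ∀ t, (∃ S ∈ ((A.highStep M δ)^[t] s).reports, Q.IsSolution S) ∨
      ∃ P ∈ ((A.highStep M δ)^[t] s).openList, ∀ c, ConstrAvoid S ε c (P.constraints c) := by
    intro t
    induction t with
    | zero =>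
      obtain ⟨P, hP, hnil⟩ := hroot fun i => hlead i [] (by simp [ConstrAvoid])
      exact Or.inr ⟨P, hP, fun c => by simp [hnil, ConstrAvoid]⟩
    | succ t ih =>
      rw [Function.iterate_succ_apply']
      exact highStep_reports_or hlow hcl hopt hlead (iterate_highStep_ok hlow hok t) ih
  refine (key t).resolve_right ?_
  rw [ht]
  simp

end Planner

/-! ### Primitives that follow a whole reference trajectory -/

/-- A trajectory as a single motion primitive. -/
def Traj.toPrim {R : Robot dw} (T : Traj R) : R.Prim := ⟨T.K, T.x 0, fun k => T.u k⟩

theorem Traj.action_toPrim {R : Robot dw} (T : Traj R) {k : ℕ} (hk : k < T.K) :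
    T.toPrim.action k = T.u k :=
  dif_pos hk

namespace Problem.IsSolution

variable {Q : Problem dw} {S : Q.Joint}

theorem state_toPrim (hS : Q.IsSolution S) (i : Fin Q.N) {k : ℕ} (hk : k ≤ (S i).K) :
    (S i).toPrim.state Q.dt k = (S i).x k := by
  induction k with
  | zero => rfl
  | succ k ih =>
    rw [hS.dynamics i k hk, Robot.Prim.state, ih (by omega), (S i).action_toPrim hk]

theorem valid_toPrim (hS : Q.IsSolution S) {i : Fin Q.N} (hK : 0 < (S i).K) :
    (S i).toPrim.Valid Q.dt := by
  refine ⟨hK, fun k hk => ?_, fun k hk => ?_⟩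
  · rw [(S i).action_toPrim hk]
    exact hS.action_mem i k hk
  · rw [hS.state_toPrim i hk]
    exact (hS.free i k hk).1

theorem start_free (hS : Q.IsSolution S) (i : Fin Q.N) : Q.StateFree i (Q.robot i).start :=
  hS.start i ▸ hS.free i 0 (Nat.zero_le _)

theorem goal_mem (hS : Q.IsSolution S) (i : Fin Q.N) : (Q.robot i).goal ∈ (Q.robot i).X :=
  hS.goal i ▸ (hS.free i _ le_rfl).1

/-- A primitive sufficiently close to a solution with clearance leads to the goal, whatever the
constraints that stay away from the solution. -/
theorem exists_leadsToGoal (hS : Q.IsSolution S) {ε : ℝ} (hε : 0 < ε) (hcl : Q.HasClearance S ε)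
    (A : Planner Q) (hα : 0 < A.α ∧ A.α < 1) {i : Fin Q.N} (hR : (Q.robot i).Regular)
    (hK : 0 < (S i).K) :
    ∃ c > 0, ∃ δ₁ > 0, ∀ δ, 0 < δ → δ ≤ δ₁ → ∀ q : (Q.robot i).Prim, q.Valid Q.dt →
      Robot.Prim.Near (c * δ) (S i).toPrim q → ∀ C, Planner.ConstrAvoid S ε i C →
        A.LeadsToGoal i δ C ((Planner.lowInit i).node 0) q := by
  obtain ⟨L, hL, hd⟩ := hR.exists_pos_dist_le
  obtain ⟨b, hb, r₀, hr₀, htrack⟩ := Robot.exists_norm_state_sub_le hR (hS.valid_toPrim hK)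
  have hα0 := hα.1
  -- The translated primitive strays at most `(b + 1) * c * δ` from the solution, which has to be at
  -- most `A.α * δ` in terms of `dist`.
  refine ⟨A.α / (L * (b + 1)), by positivity,
    min (ε / 2) (min r₀ ε / (A.α / (L * (b + 1)))), by positivity, ?_⟩
  intro δ hδ hδ₁ q hq hnear C hC
  have hδε : δ ≤ ε / 2 := hδ₁.trans (min_le_left _ _)
  have hr : A.α / (L * (b + 1)) * δ ≤ min r₀ ε := by
    rw [mul_comm]
    exact (le_div_iff₀ (by positivity)).1 (hδ₁.trans (min_le_right _ _))
  have hLr : L * ((b + 1) * (A.α / (L * (b + 1)) * δ)) = A.α * δ := by field_simp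
  have hr0 : 0 ≤ A.α / (L * (b + 1)) * δ := by positivity
  generalize A.α / (L * (b + 1)) * δ = r at *
  have hαδ : A.α * δ ≤ δ := by nlinarith
  have hqK : q.1 = (S i).K := hnear.1
  have hv : ‖(Q.robot i).posPart ((Q.robot i).start - q.2.1)‖ ≤ r := by
    refine (Robot.norm_posPart_le _).trans ?_
    rw [← hS.start i, norm_sub_rev]
    exact hnear.2.1
  have hstate : ∀ k ≤ (S i).K, ‖(S i).x k - q.state Q.dt k‖ ≤ b * r := by
    intro k hk
    rw [← hS.state_toPrim i hk, norm_sub_rev]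
    exact htrack r hr0 (hr.trans (min_le_left _ _)) q hq hnear k hk
  set m := (Q.robot i).applyPrim Q.dt (Q.robot i).start q with hm
  have hmx : ∀ k, m.x k = q.state Q.dt k + (Q.robot i).posPart ((Q.robot i).start - q.2.1) :=
    fun _ => rfl
  have hSX : ∀ k ≤ (S i).K, (S i).x k ∈ (Q.robot i).X := fun k hk => (hS.free i k hk).1
  have hmX : ∀ k ≤ (S i).K, m.x k ∈ (Q.robot i).X := by
    intro k hk
    have hqX := hq.2.2 k (hk.trans hqK.ge)
    refine hcl.displacement i k hk _ hqX ?_ _ (fun j hj => Robot.posPart_apply_of_notMem hj)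
      (hv.trans (hr.trans (min_le_right _ _)))
    have h1 : L * ‖(S i).x k - q.state Q.dt k‖ ≤ L * (b * r) := by
      gcongr
      exact hstate k hk
    have h2 := hd _ (hSX k hk) _ hqX
    have h3 : 0 ≤ L * r := by positivity
    linarith
  have hclose : ∀ k ≤ (S i).K, (Q.robot i).dist ((S i).x k) (m.x k) ≤ A.α * δ := by
    intro k hk
    refine (hd _ (hSX k hk) _ (hmX k hk)).trans ?_
    rw [← hLr]
    gcongr
    rw [hmx, ← sub_sub]
    refine (norm_sub_le _ _).trans ?_
    linarith [hstate k hk]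
  constructor
  · change (Q.robot i).dist (Q.robot i).start (m.x 0) ≤ _
    rw [← hS.start i]
    exact hclose 0 (Nat.zero_le _)
  · intro k hk
    have hk : k ≤ (S i).K := hk.trans hqK.le
    exact ⟨hmX k hk, hcl.obstacle i k hk _ (hmX k hk) ((hclose k hk).trans (by linarith))⟩
  · rintro ⟨e, he, -, h2, h3⟩
    change e.time ≤ 0 + q.1 at h2
    change (Q.robot i).dist (m.x (e.time - 0)) e.state ≤ δ at h3
    rw [Nat.sub_zero] at h3
    have hk : e.time ≤ (S i).K := by omega
    obtain ⟨heX, hed⟩ := hC e he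
    have := hed hk
    have := hR.dist_triangle _ (hSX _ hk) _ (hmX _ hk) _ heX
    linarith [hclose _ hk]
  · change (Q.robot i).dist (m.x q.1) _ ≤ _
    rw [hqK, ← hS.goal i, hR.dist_comm _ (hmX _ le_rfl) _ (hSX _ le_rfl)]
    exact hclose _ le_rfl

/-- An iteration reports a solution if each robot that has to move possesses a primitive that leads
to its goal whatever the constraints that stay away from a solution with clearance. -/
theorem reportsSolution (hS : Q.IsSolution S) {ε : ℝ} (hcl : Q.HasClearance S ε)
    (hreg : ∀ i, (Q.robot i).Regular) {A : Planner Q} (hα : 0 < A.α ∧ A.α < 1)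
    {δ : ℝ} (hδ : 0 < δ) (hδε : δ < ε)
    (hopt : ∀ Y : Q.Joint, (∀ i, Q.DiscBounded i (2 * δ) (Y i)) →
      (∀ i j k, ¬ Q.Conflict Y i j k) → ∃ S, A.opt Y = some S ∧ Q.IsSolution S)
    {M : ∀ i, List (Q.robot i).Prim} (hM : ∀ i, ∀ p ∈ M i, p.Valid Q.dt)
    (hlead : ∀ i, 0 < (S i).K → ∃ p ∈ M i, ∀ C, Planner.ConstrAvoid S ε i C →
      A.LeadsToGoal i δ C ((Planner.lowInit i).node 0) p) :
    A.ReportsSolution M δ := by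
  obtain ⟨K, hlow⟩ := A.exists_lowLevelOK hreg hα hδ hS.start_free hS.goal_mem hM
  refine Planner.reportsSolution hreg hδ hlow hcl hopt fun i C hC => ?_
  refine A.exists_dbAstar_eq_some_some (hreg i) hα hδ (hS.start_free i) (hS.goal_mem i) (hM i) ?_ ?_
  · intro e he he0
    have := (hC e he).2 (by omega)
    rw [he0, hS.start i] at this
    linarith
  · rcases Nat.eq_zero_or_pos (S i).K with hK | hK
    · left
      have hsg : (Q.robot i).goal = (Q.robot i).start := by rw [← hS.goal i, hK, hS.start i]
      rw [hsg, (hreg i).dist_self _ (hS.start_free i).1]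
      exact hδ.le
    · obtain ⟨p, hp, hpC⟩ := hlead i hK
      exact Or.inr ⟨p, hp, hpC C hC⟩

end Problem.IsSolution

theorem Problem.DiscBounded.mono {Q : Problem dw} {i : Fin Q.N} {δ η : ℝ} {T : Traj (Q.robot i)}
    (hT : Q.DiscBounded i δ T) (h : δ ≤ η) : Q.DiscBounded i η T :=
  ⟨fun k hk => (hT.jump k hk).trans h, hT.action_mem, hT.free, hT.start.trans h, hT.goal.trans h⟩

/-! ### Random primitives -/

theorem Robot.Prim.measurableSet_near {R : Robot dw} (r : ℝ) (p : R.Prim) :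
    MeasurableSet {q | Robot.Prim.Near r p q} := by
  refine MeasurableSpace.measurableSet_iInf.2 fun K => ?_
  have hset : Sigma.mk K ⁻¹' {q : R.Prim | Robot.Prim.Near r p q} =
      {_z | K = p.1} ∩ ({z : R.State × (Fin K → R.Action) | ‖z.1 - p.2.1‖ ≤ r} ∩
        {z | ∀ k < p.1, ‖Robot.Prim.action (R := R) ⟨K, z⟩ k - p.action k‖ ≤ r}) := rfl
  change MeasurableSet (Sigma.mk K ⁻¹' {q : R.Prim | Robot.Prim.Near r p q})
  rw [hset]
  refine (MeasurableSet.const _).inter (MeasurableSet.inter ?_ ?_)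
  · exact measurableSet_le (by fun_prop) measurable_const
  · have hall : {z : R.State × (Fin K → R.Action) | ∀ k < p.1,
        ‖Robot.Prim.action (R := R) ⟨K, z⟩ k - p.action k‖ ≤ r} =
        ⋂ k, ⋂ (_ : k < p.1), {z | ‖Robot.Prim.action (R := R) ⟨K, z⟩ k - p.action k‖ ≤ r} := by
      ext z
      simp
    rw [hall]
    refine MeasurableSet.iInter fun k => MeasurableSet.iInter fun _ => ?_
    refine measurableSet_le (Measurable.norm (Measurable.sub_const ?_ _)) measurable_const
    by_cases hk : k < K
    · simp only [Robot.Prim.action, dif_pos hk]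
      have hsnd : Measurable (Prod.snd : R.State × (Fin K → R.Action) → Fin K → R.Action) :=
        measurable_snd
      exact measurable_pi_iff.1 hsnd ⟨k, hk⟩
    · simp only [Robot.Prim.action, dif_neg hk]
      exact measurable_const

theorem ENNReal.one_sub_pow_le_inv {p : ℝ≥0∞} (hp : p ≤ 1) (s : ℕ) :
    (1 - p) ^ s ≤ (s * p)⁻¹ := by
  rw [ENNReal.le_inv_iff_mul_le]
  have hbern : (s : ℝ≥0∞) * p ≤ (1 + p) ^ s := by
    have h : (1 : ℝ≥0∞) + s * p ≤ (1 + p) ^ s := by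
      induction s with
      | zero => simp
      | succ s ih =>
        calc (1 : ℝ≥0∞) + (s + 1 : ℕ) * p = (1 + s * p) + 1 * p := by push_cast; ring
          _ ≤ (1 + p) ^ s + (1 + p) ^ s * p := by
              gcongr
              exact one_le_pow₀ le_self_add
          _ = (1 + p) ^ (s + 1) := by ring
    exact le_add_self.trans h
  calc (1 - p) ^ s * (s * p) ≤ (1 - p) ^ s * (1 + p) ^ s := by gcongr
    _ = ((1 - p) * (1 + p)) ^ s := (mul_pow _ _ _).symm
    _ ≤ 1 := by
        refine pow_le_one₀ (zero_le) ?_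
        calc (1 - p) * (1 + p) = (1 - p) + (1 - p) * p := by ring
          _ ≤ (1 - p) + 1 * p := by
              gcongr
              exact tsub_le_self
          _ = 1 := by rw [one_mul, tsub_add_cancel_of_le hp]

/-- The probability that `s` independent samples all miss a set is at most the reciprocal of the
expected number of hits. -/
theorem measure_forall_notMem_le {Ω E : Type*} [MeasurableSpace Ω] [MeasurableSpace E]
    {P : Measure Ω} [IsProbabilityMeasure P] {μ : Measure E} {X : ℕ → Ω → E}
    (hmeas : ∀ j, Measurable (X j)) (hlaw : ∀ j, P.map (X j) = μ) (hindep : iIndepFun X P)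
    {B : Set E} (hB : MeasurableSet B) (s : ℕ) :
    P {ω | ∀ j < s, X j ω ∉ B} ≤ (s * μ B)⁻¹ := by
  have hμ : IsProbabilityMeasure μ :=
    hlaw 0 ▸ Measure.isProbabilityMeasure_map (hmeas 0).aemeasurable
  have hset : {ω | ∀ j < s, X j ω ∉ B} = ⋂ j ∈ Finset.range s, X j ⁻¹' Bᶜ := by
    ext ω
    simp
  rw [hset, hindep.measure_inter_preimage_eq_mul (Finset.range s) (fun _ _ => hB.compl),
    Finset.prod_congr rfl fun j _ => by
      rw [← Measure.map_apply (hmeas j) hB.compl, hlaw j, prob_compl_eq_one_sub hB],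
    Finset.prod_const, Finset.card_range]
  exact ENNReal.one_sub_pow_le_inv prob_le_one s

end

/-! ### Probabilistic completeness -/

theorem theorem2 {dw : ℕ} (Q : Problem dw) (hdt : 0 < Q.dt)
    (hreg : ∀ i, (Q.robot i).Regular)
    -- the planner; its heuristics are arbitrary
    (A : Planner Q) (hα : 0 < A.α ∧ A.α < 1)
    -- trajectories with a sufficiently small discontinuity are optimized correctly
    (hopt : ∃ δ₀ > 0, ∀ Y : Q.Joint, (∀ i, Q.DiscBounded i δ₀ (Y i)) →
      (∀ i j k, ¬ Q.Conflict Y i j k) → ∃ S, A.opt Y = some S ∧ Q.IsSolution S)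
    -- motion primitives are sampled independently from a law of valid motions
    {Ω : Type*} [MeasurableSpace Ω] (P : Measure Ω) [IsProbabilityMeasure P]
    (μ : ∀ i, Measure (Q.robot i).Prim)
    (prim : ∀ i, ℕ → Ω → (Q.robot i).Prim)
    (hmeas : ∀ i j, Measurable (prim i j))
    (hlaw : ∀ i j, P.map (prim i j) = μ i)
    (hindep : ∀ i, iIndepFun (prim i) P)
    (hvalid : ∀ i j, ∀ᵐ ω ∂P, Robot.Prim.Valid Q.dt (prim i j ω))
    -- in iteration `n`, the first `count i n` of them are available to robot `i`
    (count : Fin Q.N → ℕ → ℕ) (hcount : ∀ i, Monotone (count i))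
    -- the discontinuity bound tends to zero, slowly in comparison to the number of primitives
    (δ : ℕ → ℝ) (hδ : ∀ n, 0 < δ n) (hδ_lim : Tendsto δ atTop (𝓝 0))
    (hdense : ∀ i, ∀ p : (Q.robot i).Prim, Robot.Prim.Valid Q.dt p → ∀ c > 0,
      Tendsto (fun n => (count i n : ℝ≥0∞) * μ i {q | Robot.Prim.Near (c * δ n) p q})
        atTop (𝓝 ⊤))
    -- there is a solution with positive clearance
    (hsol : ∃ S, Q.IsSolution S ∧ ∃ ε > 0, Q.HasClearance S ε) :
    Tendsto (fun n => P {ω | A.FoundBy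
        (fun l i => (List.range (count i l)).map fun j => prim i j ω) δ n}) atTop (𝓝 1) ∧
    Tendsto (fun n => P {ω | ¬ A.FoundBy
        (fun l i => (List.range (count i l)).map fun j => prim i j ω) δ n}) atTop (𝓝 0) := by
  obtain ⟨δ₀, hδ₀, hopt⟩ := hopt
  obtain ⟨S, hS, ε, hε, hcl⟩ := hsol
  have hlead : ∀ i, ∃ c > 0, ∃ δ₁ > 0, 0 < (S i).K → ∀ d, 0 < d → d ≤ δ₁ →
      ∀ q : (Q.robot i).Prim, q.Valid Q.dt → Robot.Prim.Near (c * d) (S i).toPrim q →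
        ∀ C, Planner.ConstrAvoid S ε i C →
          A.LeadsToGoal i d C ((Planner.lowInit i).node 0) q := by
    intro i
    by_cases hK : 0 < (S i).K
    · obtain ⟨c, hc, δ₁, hδ₁, h⟩ := hS.exists_leadsToGoal hε hcl A hα (hreg i) hK
      exact ⟨c, hc, δ₁, hδ₁, fun _ => h⟩
    · exact ⟨1, one_pos, 1, one_pos, fun h => absurd h hK⟩
  choose c hc δ₁ hδ₁ hlead using hlead
  -- In the event `miss i n`, robot `i` has to move and has no primitive close to its trajectory.
  set miss : ∀ _ : Fin Q.N, ℕ → Set Ω := fun i n =>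
    {ω | 0 < (S i).K ∧ ∀ j < count i n,
      prim i j ω ∉ {q | Robot.Prim.Near (c i * δ n) (S i).toPrim q}} with hmiss
  have hmiss_lim : ∀ i, Tendsto (fun n => P (miss i n)) atTop (𝓝 0) := by
    intro i
    by_cases hK : 0 < (S i).K
    · have hinv := tendsto_inv_iff.2 (hdense i _ (hS.valid_toPrim hK) (c i) (hc i))
      rw [ENNReal.inv_top] at hinv
      refine tendsto_of_tendsto_of_tendsto_of_le_of_le tendsto_const_nhds hinv
        (fun _ => zero_le) fun n => ?_
      exact (measure_mono fun ω hω => hω.2).trans (measure_forall_notMem_le (hmeas i) (hlaw i)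
        (hindep i) (Robot.Prim.measurableSet_near _ _) _)
    · simp [hmiss, hK]
  have hvalid' : ∀ᵐ ω ∂P, ∀ i j, Robot.Prim.Valid Q.dt (prim i j ω) :=
    ae_all_iff.2 fun i => ae_all_iff.2 fun j => hvalid i j
  have hle : ∀ᶠ n in atTop, P {ω | ¬ A.FoundBy
      (fun l i => (List.range (count i l)).map fun j => prim i j ω) δ n} ≤
      ∑ i, P (miss i n) := by
    have h1 : ∀ᶠ n in atTop, ∀ i, δ n < δ₁ i :=
      eventually_all.2 fun i => hδ_lim.eventually_lt_const (hδ₁ i)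
    filter_upwards [h1, hδ_lim.eventually_lt_const hε,
      hδ_lim.eventually_lt_const (half_pos hδ₀)] with n hn1 hn2 hn3
    calc P {ω | ¬ A.FoundBy (fun l i => (List.range (count i l)).map fun j => prim i j ω) δ n}
        ≤ P (⋃ i, miss i n) := by
          refine measure_mono_ae ?_
          filter_upwards [hvalid'] with ω hω hnot
          by_contra hcon
          have hM : ∀ l i, ∀ p ∈ (List.range (count i l)).map fun j => prim i j ω,
              Robot.Prim.Valid Q.dt p := by
            intro l i p hp
            obtain ⟨j, -, rfl⟩ := List.mem_map.1 hp
            exact hω i j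
          refine hnot ⟨n, le_rfl, fun l _ =>
            A.terminates hreg hα (hδ l) hS.start_free hS.goal_mem (hM l), ?_⟩
          refine hS.reportsSolution hcl hreg hα (hδ n) hn2 (fun Y hY hno =>
            hopt Y (fun i => (hY i).mono (by linarith)) hno) (hM n) fun i hK => ?_
          have hi : ω ∉ miss i n := fun h => hcon (Set.mem_iUnion.2 ⟨i, h⟩)
          simp only [hmiss, Set.mem_ofPred_eq, not_and, not_forall, not_not] at hi
          obtain ⟨j, hj, hnear⟩ := hi hK
          exact ⟨prim i j ω, List.mem_map.2 ⟨j, List.mem_range.2 hj, rfl⟩,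
            hlead i hK (δ n) (hδ n) (hn1 i).le _ (hω i j) hnear⟩
      _ ≤ ∑ i, P (miss i n) := measure_iUnion_fintype_le _ _
  have hsum : Tendsto (fun n => ∑ i, P (miss i n)) atTop (𝓝 0) := by
    simpa using tendsto_finsetSum Finset.univ fun i _ => hmiss_lim i
  have hfail : Tendsto (fun n => P {ω | ¬ A.FoundBy
      (fun l i => (List.range (count i l)).map fun j => prim i j ω) δ n}) atTop (𝓝 0) :=
    tendsto_of_tendsto_of_tendsto_of_le_of_le' tendsto_const_nhds hsum
      (Eventually.of_forall fun _ => zero_le) hle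
  refine ⟨?_, hfail⟩
  -- The events need not be measurable, so that only subadditivity is available for complements.
  have hone : Tendsto (fun n => 1 - P {ω | ¬ A.FoundBy
      (fun l i => (List.range (count i l)).map fun j => prim i j ω) δ n}) atTop (𝓝 1) := by
    simpa using ENNReal.Tendsto.sub tendsto_const_nhds hfail (Or.inl ENNReal.one_ne_top)
  refine tendsto_of_tendsto_of_tendsto_of_le_of_le hone tendsto_const_nhds (fun n => ?_)
    fun _ => prob_le_one
  rw [tsub_le_iff_right, ← measure_univ (μ := P)]
  refine (measure_mono fun ω _ => ?_).trans (measure_union_le _ _)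
  exact em _
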